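/- **Setting.** Let $\{G_1,\dots,G_m\}$ be nondeterministic automata with alphabets $\Sigma_i$, an unobservable event $\tau$, and secret state sets $Q_i^S\subseteq Q_i$. Let $G=G_1\|\cdots\|G_m$ be their synchronous composition, with alphabet $\Sigma=\bigcup_i\Sigma_i$, secret states $Q^S=\{(x_1,\dots,x_m)\mid \exists i:\ x_i\in Q_i^S\}$, and language $L(G)$ of observable strings. The observer $det(H)$ of an automaton $H$ is the accessible part of its subset automaton (with $\tau$-closures and nonempty estimates). The desired observer $det_d(H)$ is the accessible part of what remains of $det(H)$ after removing the estimates that consist of secret states only. **Three-player observers.** The largest three-player observer (TPO) w.r.t. a desired observer $D$ and an observer $F$ has initial state $(d_0,f_0)$, $Y$-states $(d,f)$, $Z$-states $(d,f,e)$ and $W$-states $(d,f,e)$, $(d,f,e\to\epsilon)$, where $d,f$ are states of $D,F$ and $e$ is an event. Its transitions are all of the following: - $(d,f)\xrightarrow{e}(d,f,e)_Z$ if $f\xrightarrow{e}$; - $(d,f,e)_Z\xrightarrow{\theta}(d',f,e)_Z$ if $d\xrightarrow{\theta}d'$ (insertion of $\theta$); - $(d,f,e)_Z\xrightarrow{\epsilon}(d,f,e)_W$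 if $d\xrightarrow{e}$ and $f\xrightarrow{e}$; - $(d,f,e)_Z\xrightarrow{e\to\epsilon}(d,f,e\to\epsilon)_W$ if $f\xrightarrow{e}$ (erasure of $e$); - $(d,f,e)_W\xrightarrow{e}(d',f')$ if $d\xrightarrow{e}d'$ and $f\xrightarrow{e}f'$; - $(d,f,e\to\epsilon)_W\xrightarrow{e}(d,f')$ if $f\xrightarrow{e}f'$. A run $\omega$ is a (possibly empty) path from the initial state to a $Y$-state; it is determined by its label string. It consists of rounds $e\,\theta^1\cdots\theta^{k-1}\theta^{k}\,e$ with inserted events $\theta^1,\dots,\theta^{k-1}$ and $\theta^k\in\{\epsilon,\,e\to\epsilon\}$. The edit projection $P_e(\omega)$ is the string of the events $e$ of its rounds, and $l(\omega)$ is the concatenation of the strings $\theta^1\cdots\theta^{k-1}e$ (if $\theta^k=\epsilon$) or $\theta^1\cdots\theta^{k-1}$ (if $\theta^k=e\to\epsilon$). An edit function is a map $f_e:\Sigma^*\times\Sigma\to\Sigma^*$, extended to strings by $f_e(\varepsilon)=\varepsilon$ and $f_e(s\sigma)=f_e(s)f_e(s,\sigma)$. It is embedded in a TPO if for every $s\in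 L(G)$ there is a run $\omega$ with $P_e(\omega)=s$ and $l(\omega)=f_e(s)$. **Constraint and All Edit Structure.** Fix $n\in\mathbb N$. The edit constraint $\Phi$ says that among the edit decisions (the labels of transitions from $Z$-states) there are no $n+1$ consecutive erasures; insertions and $\epsilon$ interrupt a sequence of erasures. The All Edit Structure $AES$ of the system is the largest complete substructure of the largest TPO w.r.t. $det_d(G)$ and $det(G)$ that satisfies $\Phi$. Here a state also records the current number of consecutive erasures. Complete means that no $Z$- or $W$-state deadlocks, that no event enabled in $det(G)$ is disabled at a $Y$-state, and that every $s\in L(G)$ is $P_e(\omega)$ for some run $\omega$. **Algorithm CA-AES.** For each $i$ let: - $\sim_o$ be an opaque observation equivalence on $G_i$, i.e. an equivalence relation such that equivalent states are both secret or both non-secret and can match each other's weak transitions $\Rightarrow^s$, $s\in\Sigma_i^*$, up to equivalence; and $\tilde G_i=G_i/{\sim_o}$; - $H_{i,ob}$ be the quotient of $det(\tilde G_i)$ by an opaque bisimulation, i.e. a bisimulation that relates no estimate consisting of secret states only to one that does not; - $H_{i,b}$ be the quotient of $det(\tilde G_i)$ by a bisimulation; - $H_{i,obd}$ be the desired observer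 of $H_{i,ob}$, and $T'_i$ the largest TPO w.r.t. $H_{i,obd}$ and $H_{i,b}$. The automaton $G_i^T$ is obtained from $T'_i$ as follows. Labels $e$ from $Y$-states are kept. Labels $\theta$ from $Z$-states with event $e$ become $\theta_e$. Labels $e$ from $W$-states with action $a$ become $e_{a,w}$. The $Y$-states are marked. Every event $\alpha\in\Sigma_j\setminus\Sigma_i$, $j\ne i$, is added as a self-loop at every $Y$-state. For such $\alpha$ and $\sigma\in\Sigma_i\cap\Sigma_j$, the events $\sigma_\alpha,\sigma_{\alpha,w},\sigma_{\alpha\to\epsilon,w}$ are added to the alphabet. Only the events $\theta_e$ are controllable. The renaming $\rho$ removes the subscripts. The specification $K$ has states $x_1,\dots,x_{n+2}$, of which $x_1$ is initial and all but $x_{n+2}$ are marked. From each $x_i$ with $i\le n+1$, every erasure $(\alpha\to\epsilon)_\alpha$ leads to $x_{i+1}$, and every $\epsilon_\alpha$ and every insertion $\alpha_\sigma$ leads to $x_1$; $x_{n+2}$ has no outgoing transitions. Let $\mathcal S$ be the least restrictive controllable and nonblocking supervisor of $\{G_1^T,\dots,G_m^T,K\}$, i.e. the largest accessible, controllable and nonblocking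 subautomaton of $G_1^T\|\cdots\|G_m^T\|K$. **Theorem (soundness of Algorithm CA-AES).** 1. For every string $t$ of $\mathcal S$ that ends in a marked state, $\rho(t)$ is the label string of a sequence of rounds. 2. For every $t\in L(\mathcal S)$ such that $\rho(t)$ is the label string of a sequence of rounds $\omega$: $\omega$ is a run of $AES$, $s:=P_e(\rho(t))\in L(G)$, and there is an edit function $f_e$ embedded in $AES$ with $l(\rho(t))=f_e(s)$. 3. Every edit function $f_e$ such that for all $s\in L(G)$ there is $t\in L(\mathcal S)$ with $P_e(\rho(t))=s$ and $l(\rho(t))=f_e(s)$ is embedded in $AES$. -/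

import Mathlib

/-! ### Automata -/

/-- A (nondeterministic) automaton with observable events in `E` and states in the carrier set
`states` of an ambient type `Q`. The label `none` is the unobservable event `τ`; it is never in
the alphabet. The field `marked` is only relevant for supervisory control. -/
@[ext]
structure Automaton (E : Type*) (Q : Type*) where
  alphabet : Set E
  states : Set Q
  step : Q → Option E → Q → Prop
  init : Set Q
  marked : Set Q
  step_left : ∀ {x l y}, step x l y → x ∈ states
  step_right : ∀ {x l y}, step x l y → y ∈ states
  step_event : ∀ {x e y}, step x (some e) y → e ∈ alphabet
  init_sub : init ⊆ states
  marked_sub : marked ⊆ states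

namespace Automaton

variable {E Q : Type*}

/-- `x →^t y` for a string `t` that may contain `τ`. -/
inductive Path (G : Automaton E Q) : Q → List (Option E) → Q → Prop
  | nil (x : Q) : Path G x [] x
  | cons {x y z : Q} {l : Option E} {t : List (Option E)} :
      G.step x l y → Path G y t z → Path G x (l :: t) z

/-- `x ⇒^s y`: a path whose observable part is `s` (`List.reduceOption` erases every `τ`). -/
def WPath (G : Automaton E Q) (x : Q) (s : List E) (y : Q) : Prop :=
  ∃ t : List (Option E), t.reduceOption = s ∧ G.Path x t y

def Reachable (G : Automaton E Q) (x : Q) : Prop :=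
  ∃ x₀ ∈ G.init, ∃ t, G.Path x₀ t x

def Coreachable (G : Automaton E Q) (x : Q) : Prop :=
  ∃ y ∈ G.marked, ∃ t, G.Path x t y

/-- The language of an automaton. -/
def lang (G : Automaton E Q) : Set (List E) :=
  {s | ∃ x₀ ∈ G.init, ∃ y, G.WPath x₀ s y}

/-- The marked language: strings that may end in a marked state. -/
def markedLang (G : Automaton E Q) : Set (List E) :=
  {s | ∃ x₀ ∈ G.init, ∃ y ∈ G.marked, G.WPath x₀ s y}

/-- The subautomaton relation. -/
structure Sub (A B : Automaton E Q) : Prop where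
  alphabet : A.alphabet = B.alphabet
  states : A.states ⊆ B.states
  step : ∀ x l y, A.step x l y → B.step x l y
  init : A.init ⊆ B.init
  marked : A.marked ⊆ B.marked

/-- The accessible part. -/
def acc (G : Automaton E Q) : Automaton E Q where
  alphabet := G.alphabet
  states := {x | x ∈ G.states ∧ G.Reachable x}
  step x l y := G.step x l y ∧ G.Reachable x ∧ G.Reachable y
  init := G.init
  marked := {x | x ∈ G.marked ∧ G.Reachable x}
  step_left h := ⟨G.step_left h.1, h.2.1⟩
  step_right h := ⟨G.step_right h.1, h.2.2⟩
  step_event h := G.step_event h.1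
  init_sub _ hx := ⟨G.init_sub hx, _, hx, [], Path.nil _⟩
  marked_sub _ hx := ⟨G.marked_sub hx.1, hx.2⟩

/-- Removal of the states in `V`, together with all their transitions. -/
def remove (G : Automaton E Q) (V : Set Q) : Automaton E Q where
  alphabet := G.alphabet
  states := G.states \ V
  step x l y := G.step x l y ∧ x ∉ V ∧ y ∉ V
  init := G.init \ V
  marked := G.marked \ V
  step_left h := ⟨G.step_left h.1, h.2.1⟩
  step_right h := ⟨G.step_right h.1, h.2.2⟩
  step_event h := G.step_event h.1
  init_sub _ hx := ⟨G.init_sub hx.1, hx.2⟩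
  marked_sub _ hx := ⟨G.marked_sub hx.1, hx.2⟩

/-- The quotient automaton modulo an equivalence relation. -/
def quot (G : Automaton E Q) (r : Setoid Q) : Automaton E (Quotient r) where
  alphabet := G.alphabet
  states := Quotient.mk r '' G.states
  step c l d := ∃ x y, G.step x l y ∧ Quotient.mk r x = c ∧ Quotient.mk r y = d
  init := Quotient.mk r '' G.init
  marked := Quotient.mk r '' G.marked
  step_left := by rintro _ _ _ ⟨x, y, h, rfl, rfl⟩; exact ⟨x, G.step_left h, rfl⟩
  step_right := by rintro _ _ _ ⟨x, y, h, rfl, rfl⟩; exact ⟨y, G.step_right h, rfl⟩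
  step_event := by rintro _ _ _ ⟨x, y, h, rfl, rfl⟩; exact G.step_event h
  init_sub := Set.image_mono G.init_sub
  marked_sub := Set.image_mono G.marked_sub

/-- Synchronous composition of two automata. -/
def sync {Q' : Type*} (G : Automaton E Q) (H : Automaton E Q') : Automaton E (Q × Q') where
  alphabet := G.alphabet ∪ H.alphabet
  states := G.states ×ˢ H.states
  step x l y := x ∈ G.states ×ˢ H.states ∧
    ((∃ e, l = some e ∧ e ∈ G.alphabet ∩ H.alphabet ∧ G.step x.1 l y.1 ∧ H.step x.2 l y.2) ∨
     ((l = none ∨ ∃ e, l = some e ∧ e ∈ G.alphabet \ H.alphabet) ∧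
        G.step x.1 l y.1 ∧ y.2 = x.2) ∨
     ((l = none ∨ ∃ e, l = some e ∧ e ∈ H.alphabet \ G.alphabet) ∧
        y.1 = x.1 ∧ H.step x.2 l y.2))
  init := G.init ×ˢ H.init
  marked := G.marked ×ˢ H.marked
  step_left h := h.1
  step_right := by
    rintro x l y ⟨hx, ⟨e, -, -, h1, h2⟩ | ⟨-, h1, h2⟩ | ⟨-, h1, h2⟩⟩
    · exact ⟨G.step_right h1, H.step_right h2⟩
    · exact ⟨G.step_right h1, h2 ▸ hx.2⟩
    · exact ⟨h1 ▸ hx.1, H.step_right h2⟩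
  step_event := by
    rintro x e y ⟨hx, ⟨e', -, -, h1, h2⟩ | ⟨-, h1, h2⟩ | ⟨-, h1, h2⟩⟩
    · exact Or.inl (G.step_event h1)
    · exact Or.inl (G.step_event h1)
    · exact Or.inr (H.step_event h2)
  init_sub := Set.prod_mono G.init_sub H.init_sub
  marked_sub := Set.prod_mono G.marked_sub H.marked_sub

/-- Synchronous composition `G₁ ∥ ⋯ ∥ Gₘ` of a family: an event is executed jointly by all the
components that have it in their alphabets while the other ones do not move; `τ` is executed by
one component alone. -/
def syncAll {ι : Type*} {P : ι → Type*} (G : ∀ i, Automaton E (P i)) :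
    Automaton E (∀ i, P i) where
  alphabet := ⋃ i, (G i).alphabet
  states := {x | ∀ i, x i ∈ (G i).states}
  step x l y := (∀ i, x i ∈ (G i).states) ∧ (∀ i, y i ∈ (G i).states) ∧
    ((∃ e, l = some e ∧ e ∈ ⋃ i, (G i).alphabet ∧
        ∀ i, (e ∈ (G i).alphabet → (G i).step (x i) (some e) (y i)) ∧
          (e ∉ (G i).alphabet → y i = x i)) ∨
     (l = none ∧ ∃ i, (G i).step (x i) none (y i) ∧ ∀ j, j ≠ i → y j = x j))
  init := {x | ∀ i, x i ∈ (G i).init}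
  marked := {x | ∀ i, x i ∈ (G i).marked}
  step_left h := h.1
  step_right h := h.2.1
  step_event := by
    rintro x e y ⟨-, -, ⟨e', he, h, -⟩ | ⟨h, -⟩⟩
    · cases he; exact h
    · cases h
  init_sub _ hx i := (G i).init_sub (hx i)
  marked_sub _ hx i := (G i).marked_sub (hx i)

/-- The union of a class of automata. -/
def union (C : Set (Automaton E Q)) : Automaton E Q where
  alphabet := {e | ∃ A ∈ C, e ∈ A.alphabet}
  states := {x | ∃ A ∈ C, x ∈ A.states}
  step x l y := ∃ A ∈ C, A.step x l y
  init := {x | ∃ A ∈ C, x ∈ A.init}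
  marked := {x | ∃ A ∈ C, x ∈ A.marked}
  step_left := by rintro _ _ _ ⟨A, hA, h⟩; exact ⟨A, hA, A.step_left h⟩
  step_right := by rintro _ _ _ ⟨A, hA, h⟩; exact ⟨A, hA, A.step_right h⟩
  step_event := by rintro _ _ _ ⟨A, hA, h⟩; exact ⟨A, hA, A.step_event h⟩
  init_sub := by rintro _ ⟨A, hA, h⟩; exact ⟨A, hA, A.init_sub h⟩
  marked_sub := by rintro _ ⟨A, hA, h⟩; exact ⟨A, hA, A.marked_sub h⟩

theorem Path.mono {A B : Automaton E Q} (h : ∀ x l y, A.step x l y → B.step x l y)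
    {x t y} (p : A.Path x t y) : B.Path x t y := by
  induction p with
  | nil x => exact .nil x
  | cons h1 _ ih => exact .cons (h _ _ _ h1) ih

theorem union_sub {C : Set (Automaton E Q)} {P : Automaton E Q} (hne : C.Nonempty)
    (h : ∀ A ∈ C, A.Sub P) : (union C).Sub P where
  alphabet := by
    obtain ⟨A, hA⟩ := hne
    ext e
    refine ⟨?_, fun he => ⟨A, hA, (h A hA).alphabet ▸ he⟩⟩
    rintro ⟨B, hB, he⟩
    exact (h B hB).alphabet ▸ he
  states := by rintro x ⟨A, hA, hx⟩; exact (h A hA).states hx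
  step := by rintro x l y ⟨A, hA, hx⟩; exact (h A hA).step _ _ _ hx
  init := by rintro x ⟨A, hA, hx⟩; exact (h A hA).init hx
  marked := by rintro x ⟨A, hA, hx⟩; exact (h A hA).marked hx

theorem sub_union {C : Set (Automaton E Q)} {P A : Automaton E Q}
    (h : ∀ A ∈ C, A.Sub P) (hA : A ∈ C) : A.Sub (union C) where
  alphabet := (h A hA).alphabet.trans (union_sub ⟨A, hA⟩ h).alphabet.symm
  states _ hx := ⟨A, hA, hx⟩
  step _ _ _ hx := ⟨A, hA, hx⟩
  init _ hx := ⟨A, hA, hx⟩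
  marked _ hx := ⟨A, hA, hx⟩

/-! ### Supervisory control -/

/-- `K` is controllable with respect to `G`, where `uc` is the set of uncontrollable events. -/
def Controllable (uc : Set E) (K G : Automaton E Q) : Prop :=
  ∀ x ∈ K.states, ∀ y ∈ G.states, ∀ u ∈ uc, G.step x (some u) y → K.step x (some u) y

def Nonblocking (K : Automaton E Q) : Prop :=
  ∀ x ∈ K.states, K.Reachable x → K.Coreachable x

/-- Every state is reachable. -/
def Accessible (K : Automaton E Q) : Prop :=
  ∀ x ∈ K.states, K.Reachable x

/-- The controllable and nonblocking (accessible) subautomata of `G`. -/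
def controlledSubs (uc : Set E) (G : Automaton E Q) : Set (Automaton E Q) :=
  {K | K.Sub G ∧ K.Accessible ∧ K.Controllable uc G ∧ K.Nonblocking}

/-- The supremal controllable and nonblocking subautomaton, i.e. the least restrictive
controllable and nonblocking supervisor. It has no states if there is no such supervisor. -/
def supCN (uc : Set E) (G : Automaton E Q) : Automaton E Q :=
  union (controlledSubs uc G)

/-- `supCN` is the largest element of the class of which it is the supremum. -/
theorem supCN_isGreatest (uc : Set E) (G : Automaton E Q) :
    supCN uc G ∈ controlledSubs uc G ∧ ∀ K ∈ controlledSubs uc G, K.Sub (supCN uc G) := by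
  have hsub : ∀ A ∈ controlledSubs uc G, A.Sub G := fun A hA => hA.1
  have hne : (controlledSubs uc G).Nonempty := by
    refine ⟨⟨G.alphabet, ∅, fun _ _ _ => False, ∅, ∅, False.elim, False.elim, False.elim,
      subset_rfl, subset_rfl⟩, ⟨rfl, Set.empty_subset _, fun _ _ _ h => h.elim,
      Set.empty_subset _, Set.empty_subset _⟩, ?_, ?_, ?_⟩ <;> intro x hx <;> exact hx.elim
  have hs : ∀ A ∈ controlledSubs uc G, A.Sub (supCN uc G) := fun A hA => sub_union hsub hA
  refine ⟨⟨union_sub hne hsub, ?_, ?_, ?_⟩, hs⟩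
  · rintro x ⟨A, hA, hx⟩
    obtain ⟨x₀, h0, t, p⟩ := hA.2.1 x hx
    exact ⟨x₀, (hs A hA).init h0, t, p.mono (hs A hA).step⟩
  · rintro x ⟨A, hA, hx⟩ y hy u hu h
    exact ⟨A, hA, hA.2.2.1 x hx y hy u hu h⟩
  · rintro x ⟨A, hA, hx⟩ -
    obtain ⟨y, hy, t, p⟩ := hA.2.2.2 x hx (hA.2.1 x hx)
    exact ⟨y, (hs A hA).marked hy, t, p.mono (hs A hA).step⟩

/-! ### Observers and abstraction -/

/-- Unobservable reach of a set of states. -/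
def UR (G : Automaton E Q) (B : Set Q) : Set Q :=
  {y | ∃ x ∈ B, G.WPath x [] y}

/-- The estimate after the estimate `X` and the observation `e`. -/
def nextEstimate (G : Automaton E Q) (X : Set Q) (e : E) : Set Q :=
  {z | ∃ x ∈ X, ∃ y, G.step x (some e) y ∧ z ∈ G.UR {y}}

/-- The observer `det(G)`: the accessible part of the subset automaton. A transition exists only
if the new estimate is nonempty. -/
def observer (G : Automaton E Q) : Automaton E (Set Q) :=
  acc
    { alphabet := G.alphabet
      states := Set.univ
      step := fun X l Y => ∃ e, l = some e ∧ Y = G.nextEstimate X e ∧ Y.Nonempty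
      init := {G.UR G.init}
      marked := ∅
      step_left := fun _ => trivial
      step_right := fun _ => trivial
      step_event := by
        rintro X e Y ⟨e', he, rfl, z, x, -, y, h, -⟩
        cases he
        exact G.step_event h
      init_sub := Set.subset_univ _
      marked_sub := Set.subset_univ _ }

/-- The desired observer: remove the states in `V`, which violate opacity, and take the
accessible part. -/
def desired (H : Automaton E Q) (V : Set Q) : Automaton E Q :=
  (H.remove V).acc

/-- Bisimulation on `G` (an equivalence relation). -/
def IsBisimulation (G : Automaton E Q) (r : Setoid Q) : Prop :=
  ∀ x₁ ∈ G.states, ∀ x₂ ∈ G.states, r x₁ x₂ →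
    ∀ l y₁, G.step x₁ l y₁ → ∃ y₂, G.step x₂ l y₂ ∧ r y₁ y₂

/-- Opaque observation equivalence on `G` with secret states `S`. -/
def IsOpaqueObsEquiv (G : Automaton E Q) (S : Set Q) (r : Setoid Q) : Prop :=
  ∀ x₁ ∈ G.states, ∀ x₂ ∈ G.states, r x₁ x₂ →
    (∀ s y₁, G.WPath x₁ s y₁ → ∃ y₂, G.WPath x₂ s y₂ ∧ r y₁ y₂) ∧ (x₁ ∈ S ↔ x₂ ∈ S)

/-- Opaque bisimulation on the observer of `G`, with secret states `S` of `G`. -/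
def IsOpaqueBisimulation (G : Automaton E Q) (S : Set Q) (r : Setoid (Set Q)) : Prop :=
  ∀ X₁ ∈ G.observer.states, ∀ X₂ ∈ G.observer.states, r X₁ X₂ →
    (∀ (s : List E) (Y₁ : Set Q), G.observer.Path X₁ (s.map some) Y₁ →
      ∃ Y₂, G.observer.Path X₂ (s.map some) Y₂ ∧ r Y₁ Y₂) ∧ (X₁ ⊆ S ↔ X₂ ⊆ S)

end Automaton

/-! ### Three-player observers -/

/-- `Σ ∪ {ε} ∪ Σ^r`: the labels of a three-player observer. -/
inductive Label (E : Type*)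
  | ev (e : E)
  | eps
  | erase (e : E)

/-- `Σ ∪ Σ^r`: the action components of `W` states. -/
inductive WAction (E : Type*)
  | keep (e : E)
  | erase (e : E)

/-- `Y`, `Z` and `W` states; `xd` and `xf` form the information state. -/
inductive TState (E XD XF : Type*)
  | y (xd : XD) (xf : XF)
  | z (xd : XD) (xf : XF) (e : E)
  | w (xd : XD) (xf : XF) (a : WAction E)

section TPO

variable {E XD XF : Type*}

open Automaton

def TState.IsY : TState E XD XF → Prop
  | .y _ _ => True
  | _ => False

def TState.IsZ : TState E XD XF → Prop
  | .z _ _ _ => True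
  | _ => False

def TState.IsW : TState E XD XF → Prop
  | .w _ _ _ => True
  | _ => False

def WAction.event : WAction E → E
  | .keep e => e
  | .erase e => e

/-- `X_obsd × X_obs`, `(X_obsd × X_obs) × Σ` and `(X_obsd × X_obs) × (Σ ∪ Σ^r)`. -/
def tpoStates (D : Automaton E XD) (F : Automaton E XF) : Set (TState E XD XF)
  | .y xd xf => xd ∈ D.states ∧ xf ∈ F.states
  | .z xd xf e => xd ∈ D.states ∧ xf ∈ F.states ∧ e ∈ F.alphabet
  | .w xd xf a => xd ∈ D.states ∧ xf ∈ F.states ∧ a.event ∈ F.alphabet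

/-- The transitions admissible in a three-player observer with respect to the desired observer
`D` and the observer `F`. -/
inductive Admissible (D : Automaton E XD) (F : Automaton E XF) :
    TState E XD XF → Label E → TState E XD XF → Prop
  | yz {xd xf e xf'} : F.step xf (some e) xf' →
      Admissible D F (.y xd xf) (.ev e) (.z xd xf e)
  | zz {xd xf e θ xd'} : D.step xd (some θ) xd' →
      Admissible D F (.z xd xf e) (.ev θ) (.z xd' xf e)
  | zw1 {xd xf e xd' xf'} : D.step xd (some e) xd' → F.step xf (some e) xf' →
      Admissible D F (.z xd xf e) .eps (.w xd xf (.keep e))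
  | zw2 {xd xf e xf'} : F.step xf (some e) xf' →
      Admissible D F (.z xd xf e) (.erase e) (.w xd xf (.erase e))
  | wy1 {xd xf e xd' xf'} : D.step xd (some e) xd' → F.step xf (some e) xf' →
      Admissible D F (.w xd xf (.keep e)) (.ev e) (.y xd' xf')
  | wy2 {xd xf e xf'} : F.step xf (some e) xf' →
      Admissible D F (.w xd xf (.erase e)) (.ev e) (.y xd xf')

/-- The labels over the alphabet `A`. -/
def labels (A : Set E) : Set (Label E)
  | .ev e => e ∈ A
  | .eps => True
  | .erase e => e ∈ A

/-- `T` is a three-player observer with respect to `D` and `F`. -/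
structure IsTPO (D : Automaton E XD) (F : Automaton E XF)
    (T : Automaton (Label E) (TState E XD XF)) : Prop where
  alphabet : T.alphabet = labels F.alphabet
  states : T.states ⊆ tpoStates D F
  step : ∀ p l q, T.step p l q → ∃ a ∈ labels F.alphabet, l = some a ∧ Admissible D F p a q
  init : T.init = {p | ∃ xd ∈ D.init, ∃ xf ∈ F.init, p = .y xd xf}
  marked : T.marked = {p | p ∈ T.states ∧ p.IsY}

/-- The largest three-player observer with respect to `D` and `F`: all states and all admissible
transitions. The `Y` states are marked. -/
def largestTPO (D : Automaton E XD) (F : Automaton E XF) :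
    Automaton (Label E) (TState E XD XF) where
  alphabet := labels F.alphabet
  states := tpoStates D F
  step p l q := p ∈ tpoStates D F ∧ q ∈ tpoStates D F ∧
    ∃ a ∈ labels F.alphabet, l = some a ∧ Admissible D F p a q
  init := {p | ∃ xd ∈ D.init, ∃ xf ∈ F.init, p = .y xd xf}
  marked := {p | p ∈ tpoStates D F ∧ p.IsY}
  step_left h := h.1
  step_right h := h.2.1
  step_event := by
    rintro p a q ⟨-, -, a', h, h', -⟩
    cases h'
    exact h
  init_sub := by
    rintro p ⟨xd, hd, xf, hf, rfl⟩
    exact ⟨D.init_sub hd, F.init_sub hf⟩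
  marked_sub _ h := h.1

/-- All three-player observers are subautomata of the largest one, which is one itself. -/
theorem largestTPO_isLargest (D : Automaton E XD) (F : Automaton E XF) :
    IsTPO D F (largestTPO D F) ∧ ∀ T, IsTPO D F T → T.Sub (largestTPO D F) := by
  refine ⟨⟨rfl, subset_rfl, fun _ _ _ h => h.2.2, rfl, rfl⟩, fun T hT => ⟨hT.alphabet,
    hT.states, fun p l q h => ⟨hT.states (T.step_left h), hT.states (T.step_right h),
      hT.step _ _ _ h⟩, hT.init.subset, ?_⟩⟩
  intro p hp
  rw [hT.marked] at hp
  exact ⟨hT.states hp.1, hp.2⟩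

/-! ### Runs and edit functions -/

/-- One round `y →^e z →^θ₁ ⋯ →^θ_{m-1} z →^θ_m w →^e y'` of a run: the events `θ₁, …, θ_{m-1}`
are inserted, and `θ_m` is `e → ε` or `ε` according to whether `e` is erased or not. -/
structure Round (E : Type*) where
  event : E
  inserted : List E
  erased : Bool

def Round.word (c : Round E) : List (Label E) :=
  .ev c.event :: (c.inserted.map .ev ++
    [if c.erased then .erase c.event else .eps, .ev c.event])

def Round.output (c : Round E) : List E :=
  c.inserted ++ if c.erased then [] else [c.event]

/-- The label sequence of the run that consists of the given rounds. -/
def runWord (ω : List (Round E)) : List (Label E) := ω.flatMap Round.word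

/-- The string `l(ω)` generated by a run. -/
def runString (ω : List (Round E)) : List E := ω.flatMap Round.output

/-- The edit projection `P_e(ω)`. -/
def editProj (ω : List (Round E)) : List E := ω.map Round.event

/-- A deterministic edit function: `f s σ` is the output for the event `σ` after the string `s`. -/
abbrev EditFunction (E : Type*) := List E → E → List E

def EditFunction.outputFrom (f : EditFunction E) : List E → List E → List E
  | _, [] => []
  | s, e :: u => f s e ++ f.outputFrom (s ++ [e]) u

/-- The string-based edit function. -/
def EditFunction.output (f : EditFunction E) (s : List E) : List E := f.outputFrom [] s

theorem EditFunction.output_nil (f : EditFunction E) : f.output [] = [] := rfl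

theorem EditFunction.output_snoc (f : EditFunction E) (s : List E) (e : E) :
    f.output (s ++ [e]) = f.output s ++ f s e := by
  have : ∀ u v, f.outputFrom v (u ++ [e]) = f.outputFrom v u ++ f (v ++ u) e := by
    intro u
    induction u with
    | nil => intro v; simp [EditFunction.outputFrom]
    | cons a u ih => intro v; simp [EditFunction.outputFrom, ih]
  simpa [EditFunction.output] using this s []

/-! ### The edit constraint and the All Edit Structure -/

/-- The number of consecutive erasures up to now, updated by a transition with label `a` from the
state `p`. The edit decisions are the labels of transitions from `Z` states: an erasure increases
the number by one, every other decision resets it to zero. -/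
def erasureCount : TState E XD XF → Label E → ℕ → ℕ
  | .z _ _ _, .erase _, k => k + 1
  | .z _ _ _, _, _ => 0
  | _, _, k => k

/-- The three-player observer `T` under the constraint that there are no `n + 1` consecutive
erasures. The constraint depends on the past decisions, so that a state is a state of `T` together
with the number of consecutive erasures that led to it. -/
def constrained (n : ℕ) (T : Automaton (Label E) (TState E XD XF)) :
    Automaton (Label E) (TState E XD XF × ℕ) where
  alphabet := T.alphabet
  states := {p | p.1 ∈ T.states ∧ p.2 ≤ n}
  step p l q := T.step p.1 l q.1 ∧ p.2 ≤ n ∧ q.2 ≤ n ∧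
    ∃ a, l = some a ∧ q.2 = erasureCount p.1 a p.2
  init := {p | p.1 ∈ T.init ∧ p.2 = 0}
  marked := {p | p.1 ∈ T.marked ∧ p.2 ≤ n}
  step_left h := ⟨T.step_left h.1, h.2.1⟩
  step_right h := ⟨T.step_right h.1, h.2.2.1⟩
  step_event h := T.step_event h.1
  init_sub _ h := ⟨T.init_sub h.1, h.2.le.trans (Nat.zero_le _)⟩
  marked_sub _ h := ⟨T.marked_sub h.1, h.2⟩

/-- `ω` is a run of `A`: it starts in the initial state and ends in a `Y` state. -/
def HasRun (A : Automaton (Label E) (TState E XD XF × ℕ)) (ω : List (Round E)) : Prop :=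
  ∃ p ∈ A.init, ∃ q, q.1.IsY ∧ A.Path p ((runWord ω).map some) q

/-- Completeness of a substructure `A` of `T` for a system with language `L`: there are no
deadlocking `Z` or `W` states, no output of the system is disabled at a `Y` state, and every
string of the system is processed by some run. -/
structure IsCompleteTPO (T : Automaton (Label E) (TState E XD XF × ℕ)) (L : Set (List E))
    (A : Automaton (Label E) (TState E XD XF × ℕ)) : Prop where
  z_alive : ∀ p ∈ A.states, p.1.IsZ → ∃ l q, A.step p l q
  w_alive : ∀ p ∈ A.states, p.1.IsW → ∃ l q, A.step p l q
  y_closed : ∀ p ∈ A.states, p.1.IsY → ∀ l q, T.step p l q → A.step p l q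
  total : ∀ s ∈ L, ∃ ω, HasRun A ω ∧ editProj ω = s

/-- The complete three-player observers with respect to `D` and `F` that satisfy the constraint. -/
def completeTPOs (n : ℕ) (D : Automaton E XD) (F : Automaton E XF) (L : Set (List E)) :
    Set (Automaton (Label E) (TState E XD XF × ℕ)) :=
  {A | A.Sub (constrained n (largestTPO D F)) ∧ IsCompleteTPO (constrained n (largestTPO D F)) L A}

/-- The All Edit Structure: the largest complete three-player observer that satisfies the
constraint. It is empty if there is no such observer. -/
def allEditStructure (n : ℕ) (D : Automaton E XD) (F : Automaton E XF) (L : Set (List E)) :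
    Automaton (Label E) (TState E XD XF × ℕ) :=
  union (completeTPOs n D F L)

/-- The All Edit Structure is the largest complete three-player observer if there is any. -/
theorem allEditStructure_isGreatest (n : ℕ) (D : Automaton E XD) (F : Automaton E XF)
    (L : Set (List E)) (hne : (completeTPOs n D F L).Nonempty) :
    allEditStructure n D F L ∈ completeTPOs n D F L ∧
      ∀ A ∈ completeTPOs n D F L, A.Sub (allEditStructure n D F L) := by
  have hsub : ∀ A ∈ completeTPOs n D F L, A.Sub (constrained n (largestTPO D F)) :=
    fun A hA => hA.1
  have hs : ∀ A ∈ completeTPOs n D F L, A.Sub (allEditStructure n D F L) :=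
    fun A hA => sub_union hsub hA
  refine ⟨⟨union_sub hne hsub, ⟨?_, ?_, ?_, ?_⟩⟩, hs⟩
  · rintro p ⟨A, hA, hp⟩ hz
    obtain ⟨l, q, h⟩ := hA.2.z_alive p hp hz
    exact ⟨l, q, A, hA, h⟩
  · rintro p ⟨A, hA, hp⟩ hz
    obtain ⟨l, q, h⟩ := hA.2.w_alive p hp hz
    exact ⟨l, q, A, hA, h⟩
  · rintro p ⟨A, hA, hp⟩ hy l q h
    exact ⟨A, hA, hA.2.y_closed p hp hy l q h⟩
  · intro s hsL
    obtain ⟨A, hA⟩ := hne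
    obtain ⟨ω, ⟨p, hp, q, hq, hpath⟩, hω⟩ := hA.2.total s hsL
    exact ⟨ω, ⟨p, (hs A hA).init hp, q, hq, hpath.mono (hs A hA).step⟩, hω⟩

/-- `f` is embedded in `A`, for a system with language `L`. -/
def EditFunction.EmbeddedIn (f : EditFunction E) (L : Set (List E))
    (A : Automaton (Label E) (TState E XD XF × ℕ)) : Prop :=
  ∀ s ∈ L, ∃ ω, HasRun A ω ∧ editProj ω = s ∧ runString ω = f.output s

/-! ### Transformation of three-player observers to automata -/

/-- Events of the transformed automata: `e` (from `Y` states), `θ_e` (from `Z` states with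
observable event component `e`) and `e_{a,w}` (from `W` states with action component `a`). -/
inductive TEvent (E : Type*)
  | plain (e : E)
  | dec (θ : Label E) (e : E)
  | env (e : E) (a : WAction E)

/-- The renaming `ρ`. -/
def TEvent.rename : TEvent E → Label E
  | .plain e => .ev e
  | .dec θ _ => θ
  | .env e _ => .ev e

/-- Events from `Y` and `W` states are uncontrollable. -/
def TEvent.uncontrollable (E : Type*) : Set (TEvent E)
  | .plain _ => True
  | .dec _ _ => False
  | .env _ _ => True

/-- The observable events of a three-player observer. -/
def observables {Q : Type*} (T : Automaton (Label E) Q) : Set E := {e | .ev e ∈ T.alphabet}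

/-- Transitions of the monolithic transformed automaton. -/
inductive MonoStep (T : Automaton (Label E) (TState E XD XF)) :
    TState E XD XF → Option (TEvent E) → TState E XD XF → Prop
  | y {xd xf e q} : T.step (.y xd xf) (some (.ev e)) q →
      MonoStep T (.y xd xf) (some (.plain e)) q
  | z {xd xf e θ q} : T.step (.z xd xf e) (some θ) q →
      MonoStep T (.z xd xf e) (some (.dec θ e)) q
  | w {xd xf a e q} : T.step (.w xd xf a) (some (.ev e)) q →
      MonoStep T (.w xd xf a) (some (.env e a)) q

/-- The monolithic transformed automaton `M^T`. -/
def monoAutomaton (T : Automaton (Label E) (TState E XD XF)) :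
    Automaton (TEvent E) (TState E XD XF) where
  alphabet := {u | (∃ e ∈ observables T, u = .plain e) ∨
    (∃ θ ∈ T.alphabet, ∃ xd xf e, .z xd xf e ∈ T.states ∧ u = .dec θ e) ∨
    (∃ e ∈ observables T, ∃ xd xf a, .w xd xf a ∈ T.states ∧ u = .env e a)}
  states := T.states
  step := MonoStep T
  init := T.init
  marked := {p | p ∈ T.states ∧ p.IsY}
  step_left := by rintro _ _ _ (h | h | h) <;> exact T.step_left h
  step_right := by rintro _ _ _ (h | h | h) <;> exact T.step_right h
  step_event := by
    rintro _ _ _ (h | h | h)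
    · exact Or.inl ⟨_, T.step_event h, rfl⟩
    · exact Or.inr (Or.inl ⟨_, T.step_event h, _, _, _, T.step_left h, rfl⟩)
    · exact Or.inr (Or.inr ⟨_, T.step_event h, _, _, _, T.step_left h, rfl⟩)
  init_sub := T.init_sub
  marked_sub _ h := h.1

end TPO

section Modular

variable {E ι : Type*} {XD XF : ι → Type*}

open Automaton

/-- The transformed automaton `G_i^T` in a system of three-player observers: at the `Y` states
there are self-loops with the events of the other components, and a shared event `σ` decorated
with an event `α` of another component that is not an event of component `i` belongs to the
alphabet (and is hence disabled by component `i`). -/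
def transformed (T : ∀ i, Automaton (Label E) (TState E (XD i) (XF i))) (i : ι) :
    Automaton (TEvent E) (TState E (XD i) (XF i)) where
  alphabet := (monoAutomaton (T i)).alphabet ∪
    {u | ∃ j, j ≠ i ∧ ∃ α ∈ observables (T j) \ observables (T i), u = .plain α ∨
      ∃ σ ∈ observables (T i) ∩ observables (T j),
        u = .dec (.ev σ) α ∨ u = .env σ (.keep α) ∨ u = .env σ (.erase α)}
  states := (T i).states
  step p l q := (monoAutomaton (T i)).step p l q ∨
    (p ∈ (T i).states ∧ p.IsY ∧ q = p ∧
      ∃ j, j ≠ i ∧ ∃ α ∈ observables (T j) \ observables (T i), l = some (.plain α))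
  init := (monoAutomaton (T i)).init
  marked := (monoAutomaton (T i)).marked
  step_left := by
    rintro _ _ _ (h | h)
    · exact (monoAutomaton (T i)).step_left h
    · exact h.1
  step_right := by
    rintro _ _ _ (h | ⟨h, -, rfl, -⟩)
    · exact (monoAutomaton (T i)).step_right h
    · exact h
  step_event := by
    rintro _ _ _ (h | ⟨-, -, -, j, hj, α, hα, h⟩)
    · exact Or.inl ((monoAutomaton (T i)).step_event h)
    · cases h
      exact Or.inr ⟨j, hj, α, hα, Or.inl rfl⟩
  init_sub := (monoAutomaton (T i)).init_sub
  marked_sub := (monoAutomaton (T i)).marked_sub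

/-- The events `(α → ε)_α` of the system of three-player observers. -/
def erasureEvents (T : ∀ i, Automaton (Label E) (TState E (XD i) (XF i))) : Set (TEvent E) :=
  {u | ∃ i xd xf e q, (T i).step (.z xd xf e) (some (.erase e)) q ∧ u = .dec (.erase e) e}

/-- The events `ε_α` and `α_σ` of the system of three-player observers. -/
def resetEvents (T : ∀ i, Automaton (Label E) (TState E (XD i) (XF i))) : Set (TEvent E) :=
  {u | ∃ i xd xf e q, (T i).step (.z xd xf e) (some .eps) q ∧ u = .dec .eps e} ∪
  {u | ∃ i xd xf e α q, (T i).step (.z xd xf e) (some (.ev α)) q ∧ u = .dec (.ev α) e}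

/-- The specification automaton `K` of the constraint that there are no `n + 1` consecutive
erasures. The state `k ≤ n + 1` is reached after `k` consecutive erasures; the last state `n + 1`
is not marked and has no outgoing transitions. -/
def specification (n : ℕ) (T : ∀ i, Automaton (Label E) (TState E (XD i) (XF i))) :
    Automaton (TEvent E) ℕ where
  alphabet := erasureEvents T ∪ resetEvents T
  states := {k | k ≤ n + 1}
  step k l k' := k ≤ n ∧
    ((∃ u ∈ erasureEvents T, l = some u ∧ k' = k + 1) ∨ (∃ u ∈ resetEvents T, l = some u ∧ k' = 0))
  init := {0}
  marked := {k | k ≤ n}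
  step_left h := Nat.le_succ_of_le h.1
  step_right := by
    rintro k l k' ⟨h, ⟨u, -, -, rfl⟩ | ⟨u, -, -, rfl⟩⟩
    · exact Nat.succ_le_succ h
    · exact Nat.zero_le _
  step_event := by
    rintro k u k' ⟨h, ⟨u', hu, h', -⟩ | ⟨u', hu, h', -⟩⟩ <;> cases h'
    · exact Or.inl hu
    · exact Or.inr hu
  init_sub := by
    rintro k rfl
    exact Nat.zero_le _
  marked_sub _ h := Nat.le_succ_of_le h

/-- The least restrictive controllable and nonblocking supervisor calculated from
`{G_1^T, …, G_m^T, K}`. -/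
def modularSupervisor (n : ℕ) (T : ∀ i, Automaton (Label E) (TState E (XD i) (XF i))) :
    Automaton (TEvent E) ((∀ i, TState E (XD i) (XF i)) × ℕ) :=
  supCN (TEvent.uncontrollable E) ((syncAll (transformed T)).sync (specification n T))

/-- The secret states of a modular system. -/
def modularSecret {Q : ι → Type*} (S : ∀ i, Set (Q i)) : Set (∀ i, Q i) :=
  {x | ∃ i, x i ∈ S i}

end Modular

section Components

variable {E Q : Type*}

open Automaton

/-- The All Edit Structure of a system with secret states `S`, with respect to its observer and
its desired observer. -/
def systemAES (n : ℕ) (G : Automaton E Q) (S : Set Q) :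
    Automaton (Label E) (TState E (Set Q) (Set Q) × ℕ) :=
  allEditStructure n (G.observer.desired {X | X ⊆ S}) G.observer G.lang

/-- The largest three-player observer of an abstracted component. The component `G` with secret
states `S` is abstracted to `G.quot r`, whose secret states are the classes of those in `S`. Its
observer is abstracted modulo `ro` to `H_ob` and modulo `rb` to `H_b`; the states of `H_ob` that
violate opacity are the classes of the estimates that contain only secret states. -/
def abstractTPO (G : Automaton E Q) (S : Set Q) (r : Setoid Q)
    (ro rb : Setoid (Set (Quotient r))) :
    Automaton (Label E) (TState E (Quotient ro) (Quotient rb)) :=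
  largestTPO
    (((G.quot r).observer.quot ro).desired
      (Quotient.mk ro '' {X | X ∈ (G.quot r).observer.states ∧ X ⊆ Quotient.mk r '' S}))
    ((G.quot r).observer.quot rb)

end Components

/-! The proof is a simulation argument. A state of the supervisor stands for a state of the largest
three-player observer of the composition, and the states that arise in this way form a complete
structure, which the All Edit Structure must contain.

Observers. A product of component estimates evolves as the estimate of the composition does
(`nextEstimate_syncAll`). Passing to classes of an opaque observation equivalence commutes with the
update of estimates (`IsOpaqueObsEquiv.nextEstimate`), and a bisimulation on the abstracted observer
transfers its transitions between representatives. Hence a tuple of abstract observer states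
represents one estimate of the composition, and joint transitions are matched there
(`isSimulation_observer`). If no component estimate is secret only, a tuple of non-secret states
shows that the product is not secret only, so desired observers are matched too
(`isSimulation_desired`). `IsModularModel` isolates what the rest of the proof needs from the
observers.

Rounds. The self-loops and the decorated events keep the components synchronized. Either all of them
are at `Y` states, or those that know the current event are at `Z` (or all at `W`) states while the
others wait at `Y` states. Each joint transition is therefore an admissible three-player transition
(`IsModularModel.exists_admissible`), and the state of the specification is the number of
consecutive erasures.

Control. Nonblockingness keeps this number at most `n` and excludes deadlocks at `Z` and `W` states;
since `plain` events are uncontrollable, no system output is disabled at a `Y` state. So the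
represented states induce a complete structure (`IsModularModel.inducedTPO_mem_completeTPOs`), and
supervised runs are runs of the All Edit Structure. These runs are closed under prefixes and extend
by every event that the system allows, so an edit function through any given run can be chosen round
by round (`exists_editFunction`). -/

namespace Automaton

variable {E Q : Type*} {G : Automaton E Q}

/-! ### Paths -/

theorem Path.append {x y z : Q} {s t : List (Option E)} (p : G.Path x s y) (q : G.Path y t z) :
    G.Path x (s ++ t) z := by
  induction p with
  | nil x => exact q
  | cons h _ ih => exact .cons h (ih q)

theorem Path.single {x y : Q} {l : Option E} (h : G.step x l y) : G.Path x [l] y :=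
  .cons h (.nil y)

theorem Path.split {s t : List (Option E)} {x z : Q} (p : G.Path x (s ++ t) z) :
    ∃ y, G.Path x s y ∧ G.Path y t z := by
  induction s generalizing x with
  | nil => exact ⟨x, .nil x, p⟩
  | cons l s ih =>
    cases p with
    | cons h p =>
      obtain ⟨y, p, q⟩ := ih p
      exact ⟨y, .cons h p, q⟩

theorem Path.mem_states {x y : Q} {t : List (Option E)} (p : G.Path x t y) (hx : x ∈ G.states) :
    y ∈ G.states := by
  induction p with
  | nil x => exact hx
  | cons h _ ih => exact ih (G.step_right h)

theorem Path.eq_map_some (hG : ∀ x y, ¬ G.step x none y) {x y : Q} {t : List (Option E)}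
    (p : G.Path x t y) : t.reduceOption.map some = t := by
  induction p with
  | nil x => rfl
  | @cons _ _ _ l t h _ ih =>
    cases l with
    | none => exact (hG _ _ h).elim
    | some e => simpa using ih

theorem WPath.path (hG : ∀ x y, ¬ G.step x none y) {x y : Q} {s : List E} (p : G.WPath x s y) :
    G.Path x (s.map some) y := by
  obtain ⟨t, rfl, p⟩ := p
  rwa [p.eq_map_some hG]

theorem Path.wpath {x y : Q} {s : List E} (p : G.Path x (s.map some) y) : G.WPath x s y :=
  ⟨_, by simp [List.reduceOption, List.filterMap_map], p⟩

/-! ### Weak paths -/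

theorem WPath.refl (G : Automaton E Q) (x : Q) : G.WPath x [] x := ⟨[], rfl, .nil x⟩

theorem WPath.trans {x y z : Q} {s t : List E} (p : G.WPath x s y) (q : G.WPath y t z) :
    G.WPath x (s ++ t) z := by
  obtain ⟨s, rfl, p⟩ := p
  obtain ⟨t, rfl, q⟩ := q
  exact ⟨s ++ t, by simp [List.reduceOption], p.append q⟩

theorem WPath.of_silent {x y : Q} (h : G.step x none y) : G.WPath x [] y :=
  ⟨[none], rfl, .single h⟩

theorem WPath.of_step {x y : Q} {e : E} (h : G.step x (some e) y) : G.WPath x [e] y :=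
  ⟨[some e], rfl, .single h⟩

theorem WPath.mem_states {x y : Q} {s : List E} (p : G.WPath x s y) (hx : x ∈ G.states) :
    y ∈ G.states :=
  p.elim fun _ h => h.2.mem_states hx

theorem WPath.cons_inv {x z : Q} {e : E} {s : List E} (p : G.WPath x (e :: s) z) :
    ∃ x' y, G.WPath x [] x' ∧ G.step x' (some e) y ∧ G.WPath y s z := by
  obtain ⟨t, ht, p⟩ := p
  induction p with
  | nil x => simp [List.reduceOption] at ht
  | @cons x y z l t h p ih =>
    cases l with
    | none =>
      obtain ⟨x', y', h1, h2, h3⟩ := ih (by simpa using ht)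
      exact ⟨x', y', (WPath.of_silent h).trans h1, h2, h3⟩
    | some a =>
      rw [List.reduceOption_cons_of_some] at ht
      cases ht
      exact ⟨x, y, .refl G x, h, t, rfl, p⟩

theorem WPath.cons {x x' y z : Q} {e : E} {s : List E} (p : G.WPath x [] x')
    (h : G.step x' (some e) y) (q : G.WPath y s z) : G.WPath x (e :: s) z := by
  simpa using (p.trans (.of_step h)).trans q

/-- Induction along a weak path without observable events. -/
theorem WPath.silent_induction {P : Q → Prop} {x y : Q} (p : G.WPath x [] y) (hx : P x)
    (h : ∀ a b, P a → G.step a none b → P b) : P y := by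
  obtain ⟨t, ht, p⟩ := p
  induction p with
  | nil x => exact hx
  | @cons x y z l t hl p ih =>
    cases l with
    | none => exact ih (h _ _ hx hl) (by simpa using ht)
    | some a => simp at ht

/-! ### Accessible parts and desired observers -/

theorem Reachable.step {x y : Q} {l : Option E} (hx : G.Reachable x) (h : G.step x l y) :
    G.Reachable y := by
  obtain ⟨x₀, h₀, t, p⟩ := hx
  exact ⟨x₀, h₀, t ++ [l], p.append (.single h)⟩

theorem acc_step_iff {x y : Q} {l : Option E} (hx : x ∈ G.acc.states) :
    G.acc.step x l y ↔ G.step x l y :=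
  ⟨fun h => h.1, fun h => ⟨h, hx.2, hx.2.step h⟩⟩

theorem desired_step_iff {V : Set Q} {x y : Q} {l : Option E} (hx : x ∈ (G.desired V).states) :
    (G.desired V).step x l y ↔ G.step x l y ∧ y ∉ V :=
  (acc_step_iff hx).trans ⟨fun h => ⟨h.1, h.2.2⟩, fun h => ⟨h.1, hx.1.2, h.2⟩⟩

/-! ### Estimates -/

/-- Sets of states that are closed under unobservable reach. -/
structure IsEstimate (G : Automaton E Q) (X : Set Q) : Prop where
  sub : X ⊆ G.states
  closed : ∀ x ∈ X, ∀ y, G.WPath x [] y → y ∈ X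

theorem isEstimate_UR {B : Set Q} (hB : B ⊆ G.states) : G.IsEstimate (G.UR B) where
  sub := by rintro y ⟨x, hx, p⟩; exact p.mem_states (hB hx)
  closed := by rintro y ⟨x, hx, p⟩ z q; exact ⟨x, hx, p.trans q⟩

theorem isEstimate_nextEstimate (G : Automaton E Q) (X : Set Q) (e : E) :
    G.IsEstimate (G.nextEstimate X e) where
  sub := by
    rintro z ⟨x, hx, y, h, y', rfl, p⟩
    exact p.mem_states (G.step_right h)
  closed := by
    rintro z ⟨x, hx, y, h, y', rfl, p⟩ z' q
    exact ⟨x, hx, _, h, _, rfl, p.trans q⟩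

theorem observer_step_iff {X Y : Set Q} {l : Option E} (hX : X ∈ G.observer.states) :
    G.observer.step X l Y ↔ ∃ e, l = some e ∧ Y = G.nextEstimate X e ∧ Y.Nonempty :=
  acc_step_iff hX

theorem observer_step_nextEstimate {X : Set Q} {e : E} (hX : X ∈ G.observer.states)
    (h : (G.nextEstimate X e).Nonempty) : G.observer.step X (some e) (G.nextEstimate X e) :=
  (observer_step_iff hX).2 ⟨e, rfl, rfl, h⟩

theorem observer_step_eq {X Y : Set Q} {e : E} (h : G.observer.step X (some e) Y) :
    Y = G.nextEstimate X e ∧ Y.Nonempty := by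
  obtain ⟨e', he, h⟩ := (observer_step_iff (G.observer.step_left h)).1 h
  cases he
  exact h

theorem observer_not_silent (X Y : Set Q) : ¬ G.observer.step X none Y := by
  intro h
  obtain ⟨e', he, -⟩ := (observer_step_iff (G.observer.step_left h)).1 h
  cases he

theorem UR_init_mem_observer (G : Automaton E Q) : G.UR G.init ∈ G.observer.states :=
  G.observer.init_sub rfl

theorem observer_path_unique {X Y Z : Set Q} {s : List E} (p : G.observer.Path X (s.map some) Y)
    (q : G.observer.Path X (s.map some) Z) : Y = Z := by
  induction s generalizing X with
  | nil => cases p; cases q; rfl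
  | cons e s ih =>
    cases p with
    | cons h p =>
      cases q with
      | cons h' q =>
        rw [(observer_step_eq h).1] at p
        rw [(observer_step_eq h').1] at q
        exact ih p q

theorem exists_observer_path {X : Set Q} (hX : X ∈ G.observer.states) (hX' : G.IsEstimate X)
    {x y : Q} (hx : x ∈ X) {s : List E} (p : G.WPath x s y) :
    ∃ Y, G.observer.Path X (s.map some) Y := by
  induction s generalizing X x with
  | nil => exact ⟨X, .nil X⟩
  | cons e s ih =>
    obtain ⟨x', z, h1, h2, h3⟩ := p.cons_inv
    have hz : z ∈ G.nextEstimate X e := ⟨x', hX'.closed x hx x' h1, z, h2, z, rfl, .refl G z⟩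
    have h := observer_step_nextEstimate hX ⟨z, hz⟩
    obtain ⟨Y, q⟩ := ih (G.observer.step_right h) (isEstimate_nextEstimate G X e) hz h3
    exact ⟨Y, .cons h q⟩

/-- Every element of an estimate is reached from some element of the previous one, and observer
transitions lead to nonempty estimates only. The induction therefore carries the statement for all
`y ∈ Y` together with nonemptiness of `Y`. -/
theorem exists_wpath_of_observer_path {X Y : Set Q} {s : List E} (hX : X.Nonempty)
    (p : G.observer.Path X (s.map some) Y) : ∃ x ∈ X, ∃ y ∈ Y, G.WPath x s y := by
  suffices h : Y.Nonempty ∧ ∀ y ∈ Y, s = [] ∧ y ∈ X ∨ ∃ x ∈ X, G.WPath x s y by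
    obtain ⟨⟨y, hy⟩, h⟩ := h
    rcases h y hy with ⟨rfl, hyX⟩ | ⟨x, hx, p⟩
    · exact ⟨y, hyX, y, hy, .refl G y⟩
    · exact ⟨x, hx, y, hy, p⟩
  induction s generalizing X with
  | nil => cases p; exact ⟨hX, fun y hy => Or.inl ⟨rfl, hy⟩⟩
  | cons e s ih =>
    cases p with
    | cons h p =>
      obtain ⟨rfl, hne⟩ := observer_step_eq h
      obtain ⟨hY, ih⟩ := ih hne p
      refine ⟨hY, fun y hy => Or.inr ?_⟩
      rcases ih y hy with ⟨rfl, x, hx, z, h, z', rfl, q⟩ | ⟨_, ⟨x, hx, z, h, z', rfl, q⟩, q'⟩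
      · exact ⟨x, hx, .cons (.refl G x) h q⟩
      · exact ⟨x, hx, .cons (.refl G x) h (q.trans q')⟩

/-- The observer generates the language of the system. -/
theorem mem_lang_iff_observer (h₀ : (G.UR G.init).Nonempty) (s : List E) :
    s ∈ G.lang ↔ ∃ Y, G.observer.Path (G.UR G.init) (s.map some) Y := by
  constructor
  · rintro ⟨x, hx, y, p⟩
    exact exists_observer_path (UR_init_mem_observer G) (isEstimate_UR G.init_sub)
      ⟨x, hx, .refl G x⟩ p
  · rintro ⟨Y, p⟩
    obtain ⟨x, ⟨x₀, hx₀, q⟩, y, -, p⟩ := exists_wpath_of_observer_path h₀ p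
    exact ⟨x₀, hx₀, y, q.trans p⟩

end Automaton

namespace Automaton

variable {E Q : Type*} {G : Automaton E Q}

/-! ### Abstraction by opaque observation equivalence -/

theorem WPath.quot (r : Setoid Q) {x y : Q} {s : List E} (p : G.WPath x s y) :
    (G.quot r).WPath (Quotient.mk r x) s (Quotient.mk r y) := by
  obtain ⟨t, rfl, p⟩ := p
  refine ⟨t, rfl, ?_⟩
  induction p with
  | nil x => exact .nil _
  | cons h _ ih => exact .cons ⟨_, _, h, rfl, rfl⟩ ih

/-- Consecutive transitions of the quotient may use different representatives. The equivalence lets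
the current state imitate each of them by a weak path, and the weak paths are concatenated. -/
theorem IsOpaqueObsEquiv.lift_wpath {S : Set Q} {r : Setoid Q} (hr : G.IsOpaqueObsEquiv S r)
    {c d : Quotient r} {s : List E} (p : (G.quot r).WPath c s d) {x : Q} (hx : x ∈ G.states)
    (hc : Quotient.mk r x = c) : ∃ y, G.WPath x s y ∧ Quotient.mk r y = d := by
  obtain ⟨t, rfl, p⟩ := p
  induction p generalizing x with
  | nil c => exact ⟨x, .refl G x, hc⟩
  | @cons c c' d l t h p ih =>
    obtain ⟨a, b, h, hac, rfl⟩ := h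
    have hax : r a x := Quotient.exact (hac.trans hc.symm)
    -- `l.toList` is the observable part of the label, which treats `τ` and events uniformly.
    have hw : G.WPath a l.toList b := by
      cases l with
      | none => exact .of_silent h
      | some e => exact .of_step h
    obtain ⟨x', hx', hb⟩ := (hr a (G.step_left h) x hx hax).1 _ _ hw
    obtain ⟨y, hy, hd⟩ := ih (hx'.mem_states hx) (Quotient.sound hb).symm
    refine ⟨y, ?_, hd⟩
    have := hx'.trans hy
    cases l <;> simpa using this

theorem IsOpaqueObsEquiv.UR_init {S : Set Q} {r : Setoid Q} (hr : G.IsOpaqueObsEquiv S r) :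
    (G.quot r).UR (G.quot r).init = Quotient.mk r '' G.UR G.init := by
  ext d
  constructor
  · rintro ⟨_, ⟨x, hx, rfl⟩, p⟩
    obtain ⟨y, hy, rfl⟩ := hr.lift_wpath p (G.init_sub hx) rfl
    exact ⟨y, ⟨x, hx, hy⟩, rfl⟩
  · rintro ⟨y, ⟨x, hx, p⟩, rfl⟩
    exact ⟨_, ⟨x, hx, rfl⟩, p.quot r⟩

/-- A lifted path may begin with silent moves before `e`. Since `X` is closed under silent reach,
they stay in `X` and the update is not affected. -/
theorem IsOpaqueObsEquiv.nextEstimate {S : Set Q} {r : Setoid Q} (hr : G.IsOpaqueObsEquiv S r)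
    {X : Set Q} (hX : G.IsEstimate X) (e : E) :
    (G.quot r).nextEstimate (Quotient.mk r '' X) e = Quotient.mk r '' G.nextEstimate X e := by
  ext d
  constructor
  · rintro ⟨_, ⟨x, hx, rfl⟩, c, h, _, rfl, p⟩
    obtain ⟨y, hy, rfl⟩ := hr.lift_wpath ((WPath.of_step h).trans p) (hX.sub hx) rfl
    obtain ⟨x', z, h1, h2, h3⟩ := WPath.cons_inv hy
    exact ⟨y, ⟨x', hX.closed x hx x' h1, z, h2, z, rfl, h3⟩, rfl⟩
  · rintro ⟨z, ⟨x, hx, y, h, _, rfl, p⟩, rfl⟩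
    exact ⟨_, ⟨x, hx, rfl⟩, _, ⟨_, _, h, rfl, rfl⟩, _, rfl, p.quot r⟩

theorem IsOpaqueBisimulation.isBisimulation {S : Set Q} {r : Setoid (Set Q)}
    (hr : G.IsOpaqueBisimulation S r) : G.observer.IsBisimulation r := by
  intro X₁ h₁ X₂ h₂ h l Y₁ hY
  cases l with
  | none => exact (observer_not_silent _ _ hY).elim
  | some e =>
    obtain ⟨Y₂, p, hY₂⟩ := (hr X₁ h₁ X₂ h₂ h).1 [e] Y₁ (.single hY)
    cases p with
    | cons h p =>
      cases p
      exact ⟨_, h, hY₂⟩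

/-- `c` is the class of the abstraction of the nonempty estimate `X` in the abstracted observer. -/
structure Abstracts (G : Automaton E Q) (r : Setoid Q) (ρ : Setoid (Set (Quotient r)))
    (X : Set Q) (c : Quotient ρ) : Prop where
  isEstimate : G.IsEstimate X
  nonempty : X.Nonempty
  mem : Quotient.mk r '' X ∈ (G.quot r).observer.states
  eq : c = Quotient.mk ρ (Quotient.mk r '' X)

theorem Abstracts.of_nextEstimate {S : Set Q} {r : Setoid Q} (hr : G.IsOpaqueObsEquiv S r)
    {ρ : Setoid (Set (Quotient r))} {X : Set Q} {c : Quotient ρ} (h : G.Abstracts r ρ X c) {e : E}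
    (hne : (G.nextEstimate X e).Nonempty) :
    ((G.quot r).observer.quot ρ).step c (some e)
        (Quotient.mk ρ (Quotient.mk r '' G.nextEstimate X e)) ∧
      G.Abstracts r ρ (G.nextEstimate X e)
        (Quotient.mk ρ (Quotient.mk r '' G.nextEstimate X e)) := by
  have hs : (G.quot r).observer.step (Quotient.mk r '' X) (some e)
      (Quotient.mk r '' G.nextEstimate X e) := by
    rw [← hr.nextEstimate h.isEstimate]
    refine observer_step_nextEstimate h.mem ?_
    rw [hr.nextEstimate h.isEstimate]
    exact hne.image _
  exact ⟨⟨_, _, hs, h.eq.symm, rfl⟩, isEstimate_nextEstimate G X e, hne,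
    (G.quot r).observer.step_right hs, rfl⟩

/-- The quotient transition starts at some representative `A` of the class `c`. The bisimulation
moves it to the representative given by the image of `X`, where the observer is deterministic and
the target is the image of the next estimate. -/
theorem Abstracts.step {S : Set Q} {r : Setoid Q} (hr : G.IsOpaqueObsEquiv S r)
    {ρ : Setoid (Set (Quotient r))} (hρ : (G.quot r).observer.IsBisimulation ρ)
    {X : Set Q} {c c' : Quotient ρ} (h : G.Abstracts r ρ X c) {e : E}
    (hs : ((G.quot r).observer.quot ρ).step c (some e) c') :
    G.Abstracts r ρ (G.nextEstimate X e) c' := by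
  obtain ⟨A, B, hAB, hA, rfl⟩ := hs
  obtain ⟨B', hB', hBB'⟩ := hρ A ((G.quot r).observer.step_left hAB) _ h.mem
    (Quotient.exact (hA.trans h.eq)) _ _ hAB
  have hm := (G.quot r).observer.step_right hB'
  obtain ⟨rfl, hne⟩ := observer_step_eq hB'
  rw [hr.nextEstimate h.isEstimate] at hm hne hBB'
  exact ⟨isEstimate_nextEstimate G X e, Set.image_nonempty.1 hne, hm, Quotient.sound hBB'⟩

theorem Abstracts.init {S : Set Q} {r : Setoid Q} (hr : G.IsOpaqueObsEquiv S r)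
    (ρ : Setoid (Set (Quotient r))) (hne : (G.UR G.init).Nonempty) {c : Quotient ρ}
    (hc : c ∈ ((G.quot r).observer.quot ρ).init) : G.Abstracts r ρ (G.UR G.init) c := by
  obtain ⟨_, rfl, rfl⟩ := hc
  refine ⟨isEstimate_UR G.init_sub, hne, ?_, ?_⟩ <;> rw [← hr.UR_init]
  exact UR_init_mem_observer _

/-! ### Estimates of synchronous compositions -/

section Product

variable {ι : Type*} {P : ι → Type*} {H : ∀ i, Automaton E (P i)}

theorem WPath.proj_syncAll {x y : ∀ i, P i} (p : (syncAll H).WPath x [] y) (i : ι) :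
    (H i).WPath (x i) [] (y i) := by
  refine p.silent_induction (P := fun z => (H i).WPath (x i) [] (z i)) (.refl _ _) ?_
  rintro a b ha ⟨-, -, ⟨e, he, -⟩ | ⟨-, j, hj, hne⟩⟩
  · cases he
  · by_cases hij : i = j
    · subst hij
      exact ha.trans (.of_silent hj)
    · rwa [hne i hij]

theorem WPath.syncAll_update [DecidableEq ι] {x : ∀ i, P i} (hx : ∀ i, x i ∈ (H i).states) {i : ι}
    {z : P i} (p : (H i).WPath (x i) [] z) :
    (syncAll H).WPath x [] (Function.update x i z) := by
  refine (p.silent_induction (P := fun z => z ∈ (H i).states ∧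
    (syncAll H).WPath x [] (Function.update x i z)) ⟨hx i, ?_⟩ ?_).2
  · simpa using WPath.refl (syncAll H) x
  · rintro a b ⟨-, ha⟩ h
    refine ⟨(H i).step_right h, ha.trans (.of_silent ⟨?_, ?_, Or.inr ⟨rfl, i, ?_, ?_⟩⟩)⟩
    · exact fun j => ha.mem_states hx j
    · intro j
      by_cases hj : j = i
      · subst hj
        simpa using (H j).step_right h
      · simpa [hj] using hx j
    · simpa using h
    · intro j hj
      simp [hj]

/-- Silent moves are executed by one component alone, so the components are moved one after the
other; this is where finiteness of the index type enters. -/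
theorem WPath.syncAll [Finite ι] {x y : ∀ i, P i} (hx : ∀ i, x i ∈ (H i).states)
    (p : ∀ i, (H i).WPath (x i) [] (y i)) : (syncAll H).WPath x [] y := by
  classical
  cases nonempty_fintype ι
  have key : ∀ s : Finset ι, (Automaton.syncAll H).WPath x [] (s.piecewise y x) := by
    intro s
    induction s using Finset.induction_on with
    | empty => simpa using WPath.refl _ x
    | insert i s hi ih =>
      rw [Finset.piecewise_insert]
      refine ih.trans (.syncAll_update (fun j => ih.mem_states hx j) ?_)
      simpa [hi] using p i
  simpa using key Finset.univ

open Classical in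
/-- The estimates of the components after the observation of `e`. -/
noncomputable def nextEstimates (H : ∀ i, Automaton E (P i)) (X : ∀ i, Set (P i)) (e : E) (i : ι) :
    Set (P i) :=
  if e ∈ (H i).alphabet then (H i).nextEstimate (X i) e else X i

theorem UR_init_syncAll [Finite ι] (H : ∀ i, Automaton E (P i)) :
    (syncAll H).UR (syncAll H).init = Set.univ.pi fun i => (H i).UR (H i).init := by
  ext y
  constructor
  · rintro ⟨x, hx, p⟩ i -
    exact ⟨x i, hx i, p.proj_syncAll i⟩
  · intro hy
    choose x hx p using fun i => hy i trivial
    exact ⟨x, hx, .syncAll (fun i => (H i).init_sub (hx i)) p⟩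

/-- The components share only observable events, and their silent moves are independent. The
uncertainty after `e` is thus again a product. -/
theorem nextEstimate_syncAll [Finite ι] {X : ∀ i, Set (P i)} (hX : ∀ i, (H i).IsEstimate (X i))
    {e : E} (he : e ∈ (syncAll H).alphabet) :
    (syncAll H).nextEstimate (Set.univ.pi X) e = Set.univ.pi (nextEstimates H X e) := by
  ext z
  constructor
  · rintro ⟨x, hx, y, ⟨-, -, ⟨e', he', -, h⟩ | ⟨h, -⟩⟩, _, rfl, p⟩ i -
    · cases he'
      unfold nextEstimates
      split_ifs with hi
      · exact ⟨x i, hx i trivial, _, (h i).1 hi, _, rfl, p.proj_syncAll i⟩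
      -- A component without `e` does not execute `e` but may move silently afterwards; closedness
      -- keeps it in its estimate.
      · exact (hX i).closed _ (hx i trivial) _ ((h i).2 hi ▸ p.proj_syncAll i)
    · cases h
  · intro hz
    have : ∀ i, ∃ x ∈ X i, ∃ y ∈ (H i).states, (e ∈ (H i).alphabet → (H i).step x (some e) y) ∧
        (e ∉ (H i).alphabet → y = x) ∧ (H i).WPath y [] (z i) := by
      intro i
      have := hz i trivial
      unfold nextEstimates at this
      split_ifs at this with hi
      · obtain ⟨x, hx, y, h, _, rfl, p⟩ := this
        exact ⟨x, hx, _, (H i).step_right h, fun _ => h, fun h => (h hi).elim, p⟩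
      · exact ⟨z i, this, z i, (hX i).sub this, fun h => (hi h).elim, fun _ => rfl, .refl _ _⟩
    choose x hx y hy h1 h2 p using this
    exact ⟨x, fun i _ => hx i, y, ⟨fun i => (hX i).sub (hx i), hy,
      Or.inl ⟨e, rfl, he, fun i => ⟨h1 i, h2 i⟩⟩⟩, y, rfl, .syncAll hy p⟩

end Product

/-! ### Simulations -/

/-- `R` relates every behaviour of `A` to a behaviour of `B`. -/
structure IsSimulation {QA QB : Type*} (A : Automaton E QA) (B : Automaton E QB)
    (R : QA → QB → Prop) : Prop where
  mem : ∀ {a b}, R a b → b ∈ B.states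
  init : ∀ a ∈ A.init, ∃ b ∈ B.init, R a b
  step : ∀ {a b}, R a b → ∀ {e a'}, A.step a (some e) a' → ∃ b', B.step b (some e) b' ∧ R a' b'

/-! ### Abstracted component observers and the observers of the composition -/

section Components

variable {ι : Type*} {P : ι → Type*} {H : ∀ i, Automaton E (P i)}
  {S : ∀ i, Set (P i)} {r : ∀ i, Setoid (P i)} {ρ : ∀ i, Setoid (Set (Quotient (r i)))}

/-- The states of the abstracted observers of the components that represent an estimate of the
composition. -/
def Represents (H : ∀ i, Automaton E (P i)) (r : ∀ i, Setoid (P i))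
    (ρ : ∀ i, Setoid (Set (Quotient (r i)))) (c : ∀ i, Quotient (ρ i)) (Y : Set (∀ i, P i)) : Prop :=
  Y ∈ (syncAll H).observer.states ∧
    ∃ X, Y = Set.univ.pi X ∧ ∀ i, (H i).Abstracts (r i) (ρ i) (X i) (c i)

theorem observer_step_pi [Finite ι] {X : ∀ i, Set (P i)} (hX : ∀ i, (H i).IsEstimate (X i))
    (hm : Set.univ.pi X ∈ (syncAll H).observer.states) {e : E} (he : e ∈ (syncAll H).alphabet)
    (hne : ∀ i, (nextEstimates H X e i).Nonempty) :
    (syncAll H).observer.step (Set.univ.pi X) (some e) (Set.univ.pi (nextEstimates H X e)) := by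
  rw [← nextEstimate_syncAll hX he]
  refine observer_step_nextEstimate hm ?_
  rw [nextEstimate_syncAll hX he]
  exact Set.univ_pi_nonempty_iff.2 hne

theorem Abstracts.nextEstimates (hr : ∀ i, (H i).IsOpaqueObsEquiv (S i) (r i))
    (hρ : ∀ i, ((H i).quot (r i)).observer.IsBisimulation (ρ i)) {X : ∀ i, Set (P i)}
    {c c' : ∀ i, Quotient (ρ i)} (hX : ∀ i, (H i).Abstracts (r i) (ρ i) (X i) (c i)) {e : E}
    (h : (syncAll fun i => ((H i).quot (r i)).observer.quot (ρ i)).step c (some e) c') (i : ι) :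
    (H i).Abstracts (r i) (ρ i) (nextEstimates H X e i) (c' i) := by
  obtain ⟨-, -, ⟨e', he', -, h⟩ | ⟨h, -⟩⟩ := h
  · cases he'
    unfold Automaton.nextEstimates
    split_ifs with hi
    · exact (hX i).step (hr i) (hρ i) ((h i).1 hi)
    · rw [(h i).2 hi]
      exact hX i
  · cases h

/-- The abstracted observers of the components are simulated by the observer. -/
theorem isSimulation_observer [Finite ι] (hr : ∀ i, (H i).IsOpaqueObsEquiv (S i) (r i))
    (hρ : ∀ i, ((H i).quot (r i)).observer.IsBisimulation (ρ i))
    (hne : ∀ i, ((H i).UR (H i).init).Nonempty) :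
    IsSimulation (syncAll fun i => ((H i).quot (r i)).observer.quot (ρ i)) (syncAll H).observer
      (Represents H r ρ) where
  mem h := h.1
  init c hc := ⟨_, rfl, UR_init_mem_observer _, _, UR_init_syncAll H,
    fun i => .init (hr i) (ρ i) (hne i) (hc i)⟩
  step := by
    rintro c _ ⟨hm, X, rfl, hX⟩ e c' h
    have hX' := Abstracts.nextEstimates hr hρ hX h
    have hs := observer_step_pi (fun i => (hX i).isEstimate) hm
      ((syncAll fun i => ((H i).quot (r i)).observer.quot (ρ i)).step_event h) fun i => (hX' i).nonempty
    exact ⟨_, hs, (syncAll H).observer.step_right hs, _, rfl, hX'⟩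

/-- A nonempty product has nonempty factors. This converse of the simulation is what later makes
system outputs executable in the plant, so that controllability can be applied to them. -/
theorem Represents.enabled [Finite ι] (hr : ∀ i, (H i).IsOpaqueObsEquiv (S i) (r i))
    {c : ∀ i, Quotient (ρ i)} {Y : Set (∀ i, P i)} (h : Represents H r ρ c Y) {e : E}
    {Y' : Set (∀ i, P i)} (hs : (syncAll H).observer.step Y (some e) Y') {i : ι}
    (hi : e ∈ (H i).alphabet) :
    ∃ c', (((H i).quot (r i)).observer.quot (ρ i)).step (c i) (some e) c' := by
  obtain ⟨hm, X, rfl, hX⟩ := h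
  have he := (syncAll H).observer.step_event hs
  obtain ⟨rfl, hne⟩ := observer_step_eq hs
  rw [nextEstimate_syncAll (fun i => (hX i).isEstimate) he, Set.univ_pi_nonempty_iff] at hne
  have := hne i
  unfold nextEstimates at this
  rw [if_pos hi] at this
  exact ⟨_, ((hX i).of_nextEstimate (hr i) this).1⟩

/-- The violating states of the abstracted observer of a component. -/
abbrev abstractViolations (G : Automaton E Q) (S : Set Q) (r : Setoid Q)
    (ρ : Setoid (Set (Quotient r))) : Set (Quotient ρ) :=
  Quotient.mk ρ '' {X | X ∈ (G.quot r).observer.states ∧ X ⊆ Quotient.mk r '' S}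

theorem Abstracts.not_subset {S : Set Q} {r : Setoid Q} {ρ : Setoid (Set (Quotient r))}
    {X : Set Q} {c : Quotient ρ} (h : G.Abstracts r ρ X c)
    (hc : c ∉ G.abstractViolations S r ρ) : ¬ X ⊆ S :=
  fun hX => hc ⟨_, ⟨h.mem, Set.image_mono hX⟩, h.eq.symm⟩

/-- A tuple is secret as soon as one entry is, so a non-secret tuple needs a non-secret entry from
every component. -/
theorem not_pi_subset_modularSecret {X : ∀ i, Set (P i)} (h : ∀ i, ¬ X i ⊆ S i) :
    ¬ Set.univ.pi X ⊆ modularSecret S := by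
  choose x hx hxS using fun i => Set.not_subset.1 (h i)
  intro hX
  obtain ⟨i, hi⟩ := hX fun i _ => hx i
  exact hxS i hi

/-- The states of the abstracted desired observers of the components that represent an estimate in
the desired observer of the composition. -/
def RepresentsDesired (H : ∀ i, Automaton E (P i)) (S : ∀ i, Set (P i)) (r : ∀ i, Setoid (P i))
    (ρ : ∀ i, Setoid (Set (Quotient (r i)))) (c : ∀ i, Quotient (ρ i)) (Y : Set (∀ i, P i)) : Prop :=
  Y ∈ ((syncAll H).observer.desired {X | X ⊆ modularSecret S}).states ∧ Represents H r ρ c Y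

/-- The transitions are matched as for the observers themselves. In addition the target must survive
the removal, which follows because every component target survives its own removal. -/
theorem isSimulation_desired [Finite ι] (hr : ∀ i, (H i).IsOpaqueObsEquiv (S i) (r i))
    (hρ : ∀ i, ((H i).quot (r i)).observer.IsBisimulation (ρ i))
    (hne : ∀ i, ((H i).UR (H i).init).Nonempty) :
    IsSimulation
      (syncAll fun i => (((H i).quot (r i)).observer.quot (ρ i)).desired
        ((H i).abstractViolations (S i) (r i) (ρ i)))
      ((syncAll H).observer.desired {X | X ⊆ modularSecret S})
      (RepresentsDesired H S r ρ) where
  mem h := h.1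
  init c hc := by
    have hX i := Abstracts.init (hr i) (ρ i) (hne i) (hc i).1
    have hi : (syncAll H).UR (syncAll H).init ∈
        ((syncAll H).observer.desired {X | X ⊆ modularSecret S}).init := by
      refine ⟨rfl, ?_⟩
      rw [UR_init_syncAll]
      exact not_pi_subset_modularSecret fun i => (hX i).not_subset (hc i).2
    exact ⟨_, hi, (Automaton.desired _ _).init_sub hi, UR_init_mem_observer _, _,
      UR_init_syncAll H, hX⟩
  step := by
    rintro c _ ⟨hd, hm, X, rfl, hX⟩ e c' h
    have hc' i : c' i ∉ (H i).abstractViolations (S i) (r i) (ρ i) := (h.2.1 i).1.2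
    have h' : (syncAll fun i => ((H i).quot (r i)).observer.quot (ρ i)).step c (some e) c' := by
      obtain ⟨h1, h2, ⟨e', he', he, h⟩ | ⟨h, -⟩⟩ := h
      · exact ⟨fun i => (h1 i).1.1, fun i => (h2 i).1.1,
          Or.inl ⟨e', he', he, fun i => ⟨fun hi => he' ▸ ((h i).1 hi).1.1, (h i).2⟩⟩⟩
      · cases h
    have hX' := Abstracts.nextEstimates hr hρ hX h'
    have hs := observer_step_pi (fun i => (hX i).isEstimate) hm
      ((syncAll fun i => ((H i).quot (r i)).observer.quot (ρ i)).step_event h') fun i => (hX' i).nonempty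
    have hs' := (desired_step_iff (V := {X | X ⊆ modularSecret S}) hd).2
      ⟨hs, not_pi_subset_modularSecret fun i => (hX' i).not_subset (hc' i)⟩
    exact ⟨_, hs', (Automaton.desired _ _).step_right hs', (syncAll H).observer.step_right hs, _,
      rfl, hX'⟩

end Components

end Automaton

/-! ### Edit functions from extensible families of runs -/

section EditFunctions

variable {E : Type*}

theorem runWord_append (v w : List (Round E)) : runWord (v ++ w) = runWord v ++ runWord w :=
  List.flatMap_append

theorem runString_append (v w : List (Round E)) :
    runString (v ++ w) = runString v ++ runString w :=
  List.flatMap_append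

theorem editProj_append (v w : List (Round E)) : editProj (v ++ w) = editProj v ++ editProj w :=
  List.map_append

open Classical in
/-- A round with event `e` that extends `v`, inside `ω` if possible. -/
noncomputable def nextRound (P : List (Round E) → Prop) (ω v : List (Round E)) (e : E) : Round E :=
  if h : ∃ c : Round E, c.event = e ∧ v ++ [c] <+: ω then h.choose
  else if h : ∃ c : Round E, c.event = e ∧ P (v ++ [c]) then h.choose
  else ⟨e, [], false⟩

theorem nextRound_event (P : List (Round E) → Prop) (ω v : List (Round E)) (e : E) :
    (nextRound P ω v e).event = e := by
  unfold nextRound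
  split_ifs with h h'
  · exact h.choose_spec.1
  · exact h'.choose_spec.1
  · rfl

/-- Two prefixes of `ω` of the same length coincide, so the chosen round is the one that `ω` itself
takes. -/
theorem nextRound_of_prefix (P : List (Round E) → Prop) {ω v : List (Round E)} {c : Round E}
    (h : v ++ [c] <+: ω) : nextRound P ω v c.event = c := by
  have hex : ∃ c' : Round E, c'.event = c.event ∧ v ++ [c'] <+: ω := ⟨c, rfl, h⟩
  unfold nextRound
  rw [dif_pos hex]
  have := (List.prefix_of_prefix_length_le hex.choose_spec.2 h (by simp)).eq_of_length (by simp)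
  simpa using this

/-- The run chosen for a string. -/
noncomputable def chosenRun (P : List (Round E) → Prop) (ω : List (Round E)) (s : List E) :
    List (Round E) :=
  s.foldl (fun v e => v ++ [nextRound P ω v e]) []

theorem chosenRun_snoc (P : List (Round E) → Prop) (ω : List (Round E)) (s : List E) (e : E) :
    chosenRun P ω (s ++ [e]) = chosenRun P ω s ++ [nextRound P ω (chosenRun P ω s) e] := by
  simp [chosenRun]

theorem editProj_chosenRun (P : List (Round E) → Prop) (ω : List (Round E)) (s : List E) :
    editProj (chosenRun P ω s) = s := by
  induction s using List.reverseRecOn with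
  | nil => rfl
  | append_singleton s e ih =>
    rw [chosenRun_snoc, editProj_append, ih]
    simp [editProj, nextRound_event]

theorem chosenRun_editProj (P : List (Round E) → Prop) {ω v : List (Round E)} (h : v <+: ω) :
    chosenRun P ω (editProj v) = v := by
  induction v using List.reverseRecOn with
  | nil => rfl
  | append_singleton v c ih =>
    rw [editProj_append]
    change chosenRun P ω (editProj v ++ [c.event]) = _
    rw [chosenRun_snoc, ih ((List.prefix_append _ _).trans h), nextRound_of_prefix P h]

/-- One round is fixed for every string and next event, following `ω` as long as the string permits
and any extension in `P` otherwise. The output of this round depends only on the string and the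
event, hence defines an edit function, and it agrees with `ω` along `ω`. -/
theorem exists_editFunction {P : List (Round E) → Prop} {L : Set (List E)}
    (hL : ∀ s e, s ++ [e] ∈ L → s ∈ L) (hpre : ∀ v w, P (v ++ w) → P v)
    (hext : ∀ v e, P v → editProj v ++ [e] ∈ L → ∃ c : Round E, c.event = e ∧ P (v ++ [c]))
    {ω : List (Round E)} (hω : P ω) :
    ∃ f : EditFunction E, (∀ s ∈ L, ∃ v, P v ∧ editProj v = s ∧ runString v = f.output s) ∧
      runString ω = f.output (editProj ω) := by
  let f : EditFunction E := fun s e => (nextRound P ω (chosenRun P ω s) e).output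
  have hf : ∀ s, runString (chosenRun P ω s) = f.output s := by
    intro s
    induction s using List.reverseRecOn with
    | nil => rfl
    | append_singleton s e ih =>
      rw [chosenRun_snoc, runString_append, ih, EditFunction.output_snoc]
      simp [f, runString]
  refine ⟨f, fun s hs => ⟨chosenRun P ω s, ?_, editProj_chosenRun P ω s, hf s⟩, ?_⟩
  · induction s using List.reverseRecOn with
    | nil => exact hpre [] ω hω
    | append_singleton s e ih =>
      have ih := ih (hL s e hs)
      -- This rules out the default round in `nextRound`.
      have hex := hext _ e ih (by rwa [editProj_chosenRun])
      rw [chosenRun_snoc]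
      unfold nextRound
      split_ifs with h
      · obtain ⟨w, hw⟩ := h.choose_spec.2
        exact hpre _ w (by rw [hw]; exact hω)
      · exact hex.choose_spec.2
  · rw [← hf, chosenRun_editProj P List.prefix_rfl]

end EditFunctions

/-! ### Runs of three-player observers -/

section Runs

open Automaton

variable {E XD XF : Type*} {D : Automaton E XD} {F : Automaton E XF} {n : ℕ}

theorem admissible_of_constrained_step {p q : TState E XD XF × ℕ} {a : Label E}
    (h : (constrained n (largestTPO D F)).step p (some a) q) : Admissible D F p.1 a q.1 := by
  obtain ⟨-, -, a', -, ha, h⟩ := h.1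
  cases ha
  exact h

theorem constrained_path_decision {p q : TState E XD XF × ℕ} {d : XD} {f : XF} {e : E} {b : Bool}
    {θ : List E} (hp : p.1 = .z d f e)
    (h : (constrained n (largestTPO D F)).Path p
      ((θ.map Label.ev ++ [if b then Label.erase e else Label.eps, Label.ev e]).map some) q) :
    ∃ d' f', q.1 = .y d' f' ∧ F.step f (some e) f' := by
  induction θ generalizing p d with
  | nil =>
    obtain ⟨p, k⟩ := p
    cases hp
    cases h with
    | @cons _ p₁ _ _ _ h₁ h =>
      cases h with
      | @cons _ p₂ _ _ _ h₂ h =>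
        cases h
        obtain ⟨p₁, k₁⟩ := p₁
        obtain ⟨q, k₂⟩ := q
        have a₁ := admissible_of_constrained_step h₁
        have a₂ := admissible_of_constrained_step h₂
        dsimp only at a₁ a₂ ⊢
        cases b <;> cases a₁ <;> cases a₂ <;> exact ⟨_, _, rfl, ‹_›⟩
  | cons θ₀ θ ih =>
    obtain ⟨p, k⟩ := p
    cases hp
    cases h with
    | @cons _ p₁ _ _ _ h₁ h =>
      obtain ⟨p₁, k₁⟩ := p₁
      have a₁ := admissible_of_constrained_step h₁
      dsimp only at a₁
      cases a₁
      exact ih rfl h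

theorem constrained_path_round {p q : TState E XD XF × ℕ} {d : XD} {f : XF} {c : Round E}
    (hp : p.1 = .y d f)
    (h : (constrained n (largestTPO D F)).Path p (c.word.map some) q) :
    ∃ d' f', q.1 = .y d' f' ∧ F.step f (some c.event) f' := by
  obtain ⟨p, k⟩ := p
  cases hp
  cases h with
  | @cons _ p₁ _ _ _ h₁ h =>
    obtain ⟨p₁, k₁⟩ := p₁
    have a₁ := admissible_of_constrained_step h₁
    dsimp only at a₁
    cases a₁
    exact constrained_path_decision rfl h

/-- A run ends in a `Y` state whose second component is reached by the edit projection. -/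
theorem constrained_path_runWord {p q : TState E XD XF × ℕ} {d : XD} {f : XF}
    {v : List (Round E)} (hp : p.1 = .y d f)
    (h : (constrained n (largestTPO D F)).Path p ((runWord v).map some) q) :
    ∃ d' f', q.1 = .y d' f' ∧ F.Path f ((editProj v).map some) f' := by
  induction v generalizing p d f with
  | nil => cases h; exact ⟨d, f, hp, .nil f⟩
  | cons c v ih =>
    have hw : (runWord (c :: v)).map some = c.word.map some ++ (runWord v).map some := by
      simp [runWord]
    rw [hw] at h
    obtain ⟨p₁, h₁, h₂⟩ := h.split
    obtain ⟨d₁, f₁, hp₁, hf⟩ := constrained_path_round hp h₁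
    obtain ⟨d', f', hq, hpath⟩ := ih hp₁ h₂
    exact ⟨d', f', hq, .cons hf hpath⟩

/-- The label sequences that complete the current round and then consist of rounds. -/
def CompletesRuns : TState E XD XF → List (Label E) → Prop
  | .y _ _, w => ∃ ω, w = runWord ω
  | .z _ _ e, w => ∃ (θ : List E) (b : Bool) (ω : List (Round E)),
      w = θ.map .ev ++ ([if b then .erase e else .eps, .ev e] ++ runWord ω)
  | .w _ _ a, w => ∃ ω, w = .ev a.event :: runWord ω

/-- This is one backward step of the parsing of label strings into rounds: a transition from `Y`
opens a round, an insertion prolongs it, and the last two transitions close it. -/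
theorem CompletesRuns.cons {p q : TState E XD XF} {a : Label E} {w : List (Label E)}
    (h : Admissible D F p a q) (hw : CompletesRuns q w) : CompletesRuns p (a :: w) := by
  cases h with
  | @yz _ _ e =>
    obtain ⟨θ, b, ω, rfl⟩ := hw
    exact ⟨⟨e, θ, b⟩ :: ω, by simp [runWord, Round.word]⟩
  | @zz _ _ _ θ₀ =>
    obtain ⟨θ, b, ω, rfl⟩ := hw
    exact ⟨θ₀ :: θ, b, ω, rfl⟩
  | zw1 _ _ =>
    obtain ⟨ω, rfl⟩ := hw
    exact ⟨[], false, ω, rfl⟩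
  | zw2 _ =>
    obtain ⟨ω, rfl⟩ := hw
    exact ⟨[], true, ω, rfl⟩
  | wy1 _ _ =>
    obtain ⟨ω, rfl⟩ := hw
    exact ⟨ω, rfl⟩
  | wy2 _ =>
    obtain ⟨ω, rfl⟩ := hw
    exact ⟨ω, rfl⟩

theorem completesRuns_of_path {p q : TState E XD XF × ℕ} {w : List (Label E)} (hq : q.1.IsY)
    (h : (constrained n (largestTPO D F)).Path p (w.map some) q) : CompletesRuns p.1 w := by
  induction w generalizing p with
  | nil =>
    cases h
    obtain ⟨q, k⟩ := q
    cases q with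
    | y d f => exact ⟨[], rfl⟩
    | z => exact hq.elim
    | w => exact hq.elim
  | cons a w ih =>
    cases h with
    | cons h₁ h => exact (ih h).cons (admissible_of_constrained_step h₁)

end Runs

/-! ### Transitions of the transformed automata -/

section Transformed

open Automaton

variable {E ι : Type*} {XD XF : ι → Type*}

/-- The largest three-player observers of the components. -/
abbrev localTPOs (Dc : ∀ i, Automaton E (XD i)) (Fc : ∀ i, Automaton E (XF i)) (i : ι) :
    Automaton (Label E) (TState E (XD i) (XF i)) :=
  largestTPO (Dc i) (Fc i)

variable {Dc : ∀ i, Automaton E (XD i)} {Fc : ∀ i, Automaton E (XF i)} {i : ι}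

theorem transformed_not_silent (p q : TState E (XD i) (XF i)) :
    ¬ (transformed (localTPOs Dc Fc) i).step p none q := by
  rintro (h | ⟨-, -, -, _, -, _, -, h⟩)
  · cases h
  · cases h

theorem transformed_step_y {c : XD i} {b : XF i} {u : TEvent E} {q : TState E (XD i) (XF i)}
    (h : (transformed (localTPOs Dc Fc) i).step (.y c b) (some u) q) :
    ∃ e, u = .plain e ∧
      ((e ∈ (Fc i).alphabet ∧ q = .z c b e ∧ ∃ b', (Fc i).step b (some e) b') ∨
        (e ∉ (Fc i).alphabet ∧ q = .y c b)) := by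
  rcases h with h | ⟨-, -, rfl, j, -, e, ⟨-, he⟩, h⟩
  · cases h with
    | y h =>
      obtain ⟨-, -, a, -, ha, h⟩ := h
      cases ha
      cases h with
      | yz h => exact ⟨_, rfl, Or.inl ⟨(Fc i).step_event h, rfl, _, h⟩⟩
  · cases h
    exact ⟨e, rfl, Or.inr ⟨he, rfl⟩⟩

theorem transformed_step_z {c : XD i} {b : XF i} {e : E} {u : TEvent E}
    {q : TState E (XD i) (XF i)}
    (h : (transformed (localTPOs Dc Fc) i).step (.z c b e) (some u) q) :
    (∃ θ c', u = .dec (.ev θ) e ∧ q = .z c' b e ∧ θ ∈ (Fc i).alphabet ∧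
        (Dc i).step c (some θ) c') ∨
      (u = .dec .eps e ∧ q = .w c b (.keep e) ∧ (∃ c', (Dc i).step c (some e) c') ∧
        ∃ b', (Fc i).step b (some e) b') ∨
      (u = .dec (.erase e) e ∧ q = .w c b (.erase e) ∧ ∃ b', (Fc i).step b (some e) b') := by
  rcases h with h | ⟨-, h, -⟩
  · cases h with
    | z h =>
      obtain ⟨-, -, a, hl, ha, h⟩ := h
      cases ha
      cases h with
      | zz h => exact Or.inl ⟨_, _, rfl, rfl, hl, h⟩
      | zw1 h h' => exact Or.inr (Or.inl ⟨rfl, rfl, ⟨_, h⟩, _, h'⟩)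
      | zw2 h => exact Or.inr (Or.inr ⟨rfl, rfl, _, h⟩)
  · exact h.elim

theorem transformed_step_w {c : XD i} {b : XF i} {a : WAction E} {u : TEvent E}
    {q : TState E (XD i) (XF i)}
    (h : (transformed (localTPOs Dc Fc) i).step (.w c b a) (some u) q) :
    u = .env a.event a ∧ ∃ c' b', q = .y c' b' ∧ (Fc i).step b (some a.event) b' ∧
      ((a = .keep a.event ∧ (Dc i).step c (some a.event) c') ∨
        (a = .erase a.event ∧ c' = c)) := by
  rcases h with h | ⟨-, h, -⟩
  · cases h with
    | w h =>
      obtain ⟨-, -, l, -, hl, h⟩ := h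
      cases hl
      cases h with
      | wy1 h h' => exact ⟨rfl, _, _, rfl, h', Or.inl ⟨rfl, h⟩⟩
      | wy2 h => exact ⟨rfl, _, _, rfl, h, Or.inr ⟨rfl, rfl⟩⟩
  · exact h.elim

/-- Through the added self-loops a `plain` event concerns every component. Since it is possible only
at `Y` states, a round can start only when all components have finished the previous one. -/
theorem plain_mem_alphabet {e : E} (he : e ∈ ⋃ i, (Fc i).alphabet) (i : ι) :
    .plain e ∈ (transformed (localTPOs Dc Fc) i).alphabet := by
  obtain ⟨j, hj⟩ := Set.mem_iUnion.1 he
  by_cases hi : e ∈ (Fc i).alphabet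
  · exact Or.inl (Or.inl ⟨e, hi, rfl⟩)
  · exact Or.inr ⟨j, fun h => hi (h ▸ hj), e, ⟨hj, hi⟩, Or.inl rfl⟩

theorem mem_iUnion_of_plain {e : E}
    (he : .plain e ∈ (transformed (localTPOs Dc Fc) i).alphabet) :
    e ∈ ⋃ i, (Fc i).alphabet := by
  rcases he with (⟨e', h, he⟩ | ⟨_, _, _, _, _, _, he⟩ | ⟨_, _, _, _, _, _, he⟩) |
    ⟨j, -, α, hα, he | ⟨_, _, he | he | he⟩⟩ <;> cases he
  · exact Set.mem_iUnion.2 ⟨i, h⟩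
  · exact Set.mem_iUnion.2 ⟨j, hα.1⟩

theorem dec_mem_alphabet {θ : Label E} {c : XD i} {b : XF i} {e : E}
    (hz : .z c b e ∈ (transformed (localTPOs Dc Fc) i).states)
    (hθ : θ ∈ labels (Fc i).alphabet) :
    .dec θ e ∈ (transformed (localTPOs Dc Fc) i).alphabet :=
  Or.inl (Or.inr (Or.inl ⟨θ, hθ, c, b, e, hz, rfl⟩))

/-- Component `i` knows `θ` but not `e`, and it has no transition with the event decorated by `e`.
Membership in its alphabet thus blocks an insertion of `θ` in which it could not take part. -/
theorem dec_mem_alphabet_of_not_mem {θ e : E} (hi : θ ∈ (Fc i).alphabet)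
    (hi' : e ∉ (Fc i).alphabet) {j : ι} (hj : θ ∈ (Fc j).alphabet) (hj' : e ∈ (Fc j).alphabet) :
    .dec (.ev θ) e ∈ (transformed (localTPOs Dc Fc) i).alphabet :=
  Or.inr ⟨j, fun h => hi' (h ▸ hj'), e, ⟨hj', hi'⟩, Or.inr ⟨θ, ⟨hi, hj⟩, Or.inl rfl⟩⟩

theorem mem_labels_of_dec {θ : Label E} {e : E}
    (h : .dec θ e ∈ (transformed (localTPOs Dc Fc) i).alphabet) :
    θ ∈ labels (Fc i).alphabet ∧ ((∀ σ, θ ≠ .ev σ) → e ∈ (Fc i).alphabet) := by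
  rcases h with (⟨_, _, he⟩ | ⟨_, hθ, _, _, _, hz, he⟩ | ⟨_, _, _, _, _, _, he⟩) |
    ⟨j, -, α, hα, he | ⟨σ, hσ, he | he | he⟩⟩ <;> cases he
  · exact ⟨hθ, fun _ => hz.2.2⟩
  · exact ⟨hσ.1, fun h => (h σ rfl).elim⟩

theorem env_mem_alphabet {c : XD i} {b : XF i} {a : WAction E}
    (hw : .w c b a ∈ (transformed (localTPOs Dc Fc) i).states) :
    .env a.event a ∈ (transformed (localTPOs Dc Fc) i).alphabet :=
  Or.inl (Or.inr (Or.inr ⟨a.event, hw.2.2, c, b, a, hw, rfl⟩))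

theorem mem_alphabet_of_env {e : E} {a : WAction E}
    (h : .env e a ∈ (transformed (localTPOs Dc Fc) i).alphabet) : e ∈ (Fc i).alphabet := by
  rcases h with (⟨_, _, he⟩ | ⟨_, _, _, _, _, _, he⟩ | ⟨_, h, _, _, _, _, he⟩) |
    ⟨j, -, α, hα, he | ⟨σ, hσ, he | he | he⟩⟩ <;> cases he
  · exact h
  · exact hσ.1
  · exact hσ.1

end Transformed

section Modular

open Automaton

variable {E ι : Type*} {XD XF : ι → Type*} {YD YF : Type*}

/-! ### Transitions of the composition of the transformed automata -/

variable {Dc : ∀ i, Automaton E (XD i)} {Fc : ∀ i, Automaton E (XF i)}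

theorem exists_syncAll_step {P : ι → Type*} {H : ∀ i, Automaton E (P i)} {x : ∀ i, P i} {e : E}
    (hx : ∀ i, x i ∈ (H i).states) (he : e ∈ ⋃ i, (H i).alphabet)
    (h : ∀ i, e ∈ (H i).alphabet → ∃ y, (H i).step (x i) (some e) y) :
    ∃ y, (syncAll H).step x (some e) y := by
  have : ∀ i, ∃ y ∈ (H i).states, (e ∈ (H i).alphabet → (H i).step (x i) (some e) y) ∧
      (e ∉ (H i).alphabet → y = x i) := by
    intro i
    by_cases hi : e ∈ (H i).alphabet
    · obtain ⟨y, hy⟩ := h i hi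
      exact ⟨y, (H i).step_right hy, fun _ => hy, fun h => (h hi).elim⟩
    · exact ⟨x i, hx i, fun h => (hi h).elim, fun _ => rfl⟩
  choose y hy hys using this
  exact ⟨y, hx, hy, Or.inl ⟨e, rfl, he, hys⟩⟩

theorem syncAll_step_some {P : ι → Type*} {H : ∀ i, Automaton E (P i)} {x y : ∀ i, P i} {e : E}
    (h : (syncAll H).step x (some e) y) (i : ι) :
    (e ∈ (H i).alphabet → (H i).step (x i) (some e) (y i)) ∧ (e ∉ (H i).alphabet → y i = x i) := by
  obtain ⟨-, -, ⟨e', he', -, h⟩ | ⟨h, -⟩⟩ := h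
  · cases he'
    exact h i
  · cases h

/-- The parameter `p` stands for the `Z` or `W` constructor, so that both kinds of joint states are
covered. -/
theorem mem_observer_states {c : ∀ i, XD i} {b : ∀ i, XF i} {e : E}
    {p : ∀ i, XD i → XF i → TState E (XD i) (XF i)} {x : ∀ i, TState E (XD i) (XF i)}
    (hp : ∀ i d f, p i d f ∈ tpoStates (Dc i) (Fc i) → d ∈ (Dc i).states ∧ f ∈ (Fc i).states)
    (hx : ∀ i, x i ∈ tpoStates (Dc i) (Fc i))
    (h : ∀ i, (e ∈ (Fc i).alphabet → x i = p i (c i) (b i)) ∧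
      (e ∉ (Fc i).alphabet → x i = .y (c i) (b i))) (i : ι) :
    c i ∈ (Dc i).states ∧ b i ∈ (Fc i).states := by
  have hxi := hx i
  by_cases hi : e ∈ (Fc i).alphabet
  · rw [(h i).1 hi] at hxi
    exact hp i _ _ hxi
  · rw [(h i).2 hi] at hxi
    exact hxi

theorem syncAll_transformed_step_y {c : ∀ i, XD i} {b : ∀ i, XF i} {u : TEvent E}
    {x x' : ∀ i, TState E (XD i) (XF i)} (hx : ∀ i, x i = .y (c i) (b i))
    (h : (syncAll (transformed (localTPOs Dc Fc))).step x (some u) x') :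
    ∃ e ∈ ⋃ i, (Fc i).alphabet, u = .plain e ∧ (∃ b', (syncAll Fc).step b (some e) b') ∧
      ∀ i, (e ∈ (Fc i).alphabet → x' i = .z (c i) (b i) e) ∧
        (e ∉ (Fc i).alphabet → x' i = .y (c i) (b i)) := by
  have hs := syncAll_step_some h
  obtain ⟨j, hj⟩ := Set.mem_iUnion.1 ((syncAll _).step_event h)
  have hsj := (hs j).1 hj
  rw [hx j] at hsj
  obtain ⟨e, rfl, -⟩ := transformed_step_y hsj
  have he := mem_iUnion_of_plain hj
  have key : ∀ i, (e ∈ (Fc i).alphabet ∧ x' i = .z (c i) (b i) e ∧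
      ∃ b', (Fc i).step (b i) (some e) b') ∨ (e ∉ (Fc i).alphabet ∧ x' i = .y (c i) (b i)) := by
    intro i
    have hsi := (hs i).1 (plain_mem_alphabet he i)
    rw [hx i] at hsi
    obtain ⟨e', he', h⟩ := transformed_step_y hsi
    cases he'
    exact h
  refine ⟨e, he, rfl, exists_syncAll_step (fun i => ?_) he fun i hi => ?_, fun i => ?_⟩
  · have := h.1 i
    rw [hx i] at this
    exact this.2
  · rcases key i with ⟨-, -, h⟩ | ⟨h, -⟩
    · exact h
    · exact (h hi).elim
  · rcases key i with ⟨h, h', -⟩ | ⟨h, h'⟩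
    · exact ⟨fun _ => h', fun h'' => (h'' h).elim⟩
    · exact ⟨fun h'' => (h h'').elim, fun _ => h'⟩

/-- Exactly the components with `e` take part in `ε` and in the erasure. For an insertion of `θ`
these are the components with `θ`, all of which must know `e`, so it is a joint transition of the
desired observers. -/
theorem syncAll_transformed_step_z (hA : ∀ i, (Dc i).alphabet = (Fc i).alphabet)
    {c : ∀ i, XD i} {b : ∀ i, XF i} {e : E} (he : e ∈ ⋃ i, (Fc i).alphabet) {u : TEvent E}
    {x x' : ∀ i, TState E (XD i) (XF i)}
    (hx : ∀ i, (e ∈ (Fc i).alphabet → x i = .z (c i) (b i) e) ∧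
      (e ∉ (Fc i).alphabet → x i = .y (c i) (b i)))
    (h : (syncAll (transformed (localTPOs Dc Fc))).step x (some u) x') :
    (∃ θ c', u = .dec (.ev θ) e ∧ (syncAll Dc).step c (some θ) c' ∧
        ∀ i, (e ∈ (Fc i).alphabet → x' i = .z (c' i) (b i) e) ∧
          (e ∉ (Fc i).alphabet → x' i = .y (c' i) (b i))) ∨
      ((∃ b', (syncAll Fc).step b (some e) b') ∧ ∃ a : WAction E, a.event = e ∧
        ((u = .dec .eps e ∧ a = .keep e ∧ ∃ c', (syncAll Dc).step c (some e) c') ∨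
          (u = .dec (.erase e) e ∧ a = .erase e)) ∧
        ∀ i, (e ∈ (Fc i).alphabet → x' i = .w (c i) (b i) a) ∧
          (e ∉ (Fc i).alphabet → x' i = .y (c i) (b i))) := by
  have hs := syncAll_step_some h
  have hmem := mem_observer_states (p := fun i d f => .z d f e) (fun i d f h => ⟨h.1, h.2.1⟩) h.1 hx
  have hz : ∀ i, e ∈ (Fc i).alphabet →
      .z (c i) (b i) e ∈ (transformed (localTPOs Dc Fc) i).states :=
    fun i hi => (hx i).1 hi ▸ h.1 i
  have hns : ∀ i θ, ¬ (transformed (localTPOs Dc Fc) i).step (.y (c i) (b i))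
      (some (.dec θ e)) (x' i) := by
    intro i θ h
    obtain ⟨_, h, -⟩ := transformed_step_y h
    cases h
  have hsz : ∀ i, e ∈ (Fc i).alphabet → u ∈ (transformed (localTPOs Dc Fc) i).alphabet →
      (transformed (localTPOs Dc Fc) i).step (.z (c i) (b i) e) (some u) (x' i) := by
    intro i hi hu
    rw [← (hx i).1 hi]
    exact (hs i).1 hu
  obtain ⟨j, hj⟩ := Set.mem_iUnion.1 ((syncAll _).step_event h)
  -- A waiting component offers only `plain` events; these belong to every alphabet and are
  -- impossible at the `Z` state of a component with `e`.
  have hej : e ∈ (Fc j).alphabet := by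
    by_contra hej
    have hsj := (hs j).1 hj
    rw [(hx j).2 hej] at hsj
    obtain ⟨e', rfl, -⟩ := transformed_step_y hsj
    obtain ⟨i, hi⟩ := Set.mem_iUnion.1 he
    rcases transformed_step_z (hsz i hi (plain_mem_alphabet (mem_iUnion_of_plain hj) i)) with
      ⟨_, _, h, -⟩ | ⟨h, -⟩ | ⟨h, -⟩ <;> cases h
  rcases transformed_step_z (hsz j hej hj) with
    ⟨θ, -, rfl, -, hθj, -⟩ | ⟨rfl, -⟩ | ⟨rfl, -⟩
  · left
    have key : ∀ i, ∃ c' ∈ (Dc i).states, ((θ ∈ (Dc i).alphabet → (Dc i).step (c i) (some θ) c') ∧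
        (θ ∉ (Dc i).alphabet → c' = c i)) ∧ (e ∈ (Fc i).alphabet → x' i = .z c' (b i) e) ∧
        (e ∉ (Fc i).alphabet → x' i = .y c' (b i)) := by
      intro i
      rw [hA i]
      by_cases hθ : θ ∈ (Fc i).alphabet
      · by_cases hi : e ∈ (Fc i).alphabet
        · rcases transformed_step_z (hsz i hi (dec_mem_alphabet (hz i hi) hθ)) with
            ⟨_, c', h, hq, -, hc'⟩ | ⟨h, -⟩ | ⟨h, -⟩ <;> cases h
          exact ⟨c', (Dc i).step_right hc', ⟨fun _ => hc', fun h => (h hθ).elim⟩, fun _ => hq,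
            fun h => (h hi).elim⟩
        · have hsi := (hs i).1 (dec_mem_alphabet_of_not_mem hθ hi hθj hej)
          rw [(hx i).2 hi] at hsi
          -- The decorated event belongs to the alphabet of the waiting component `i`, which cannot
          -- execute it at a `Y` state.
          exact (hns i _ hsi).elim
      · rw [(hs i).2 fun h => hθ (mem_labels_of_dec h).1]
        exact ⟨c i, (hmem i).1, ⟨fun h => (hθ h).elim, fun _ => rfl⟩, hx i⟩
    choose c' hc' hstep hx' using key
    exact ⟨θ, c', rfl, ⟨fun i => (hmem i).1, hc', Or.inl ⟨θ, rfl,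
      Set.mem_iUnion.2 ⟨j, (hA j).symm ▸ hθj⟩, hstep⟩⟩, hx'⟩
  · right
    have key : ∀ i, e ∈ (Fc i).alphabet → x' i = .w (c i) (b i) (.keep e) ∧
        (∃ c', (Dc i).step (c i) (some e) c') ∧ ∃ b', (Fc i).step (b i) (some e) b' := by
      intro i hi
      rcases transformed_step_z (hsz i hi (dec_mem_alphabet (hz i hi) trivial)) with
        ⟨_, _, h, -⟩ | ⟨-, h⟩ | ⟨h, -⟩
      · cases h
      · exact h
      · cases h
    refine ⟨exists_syncAll_step (fun i => (hmem i).2) he fun i hi => (key i hi).2.2, .keep e, rfl,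
      Or.inl ⟨rfl, rfl, exists_syncAll_step (fun i => (hmem i).1)
        ((Set.iUnion_congr hA).symm ▸ he) fun i hi => (key i (hA i ▸ hi)).2.1⟩,
      fun i => ⟨fun hi => (key i hi).1, fun hi => ?_⟩⟩
    rw [(hs i).2 fun h => hi ((mem_labels_of_dec h).2 (by simp)), (hx i).2 hi]
  · right
    have key : ∀ i, e ∈ (Fc i).alphabet → x' i = .w (c i) (b i) (.erase e) ∧
        ∃ b', (Fc i).step (b i) (some e) b' := by
      intro i hi
      rcases transformed_step_z (hsz i hi (dec_mem_alphabet (hz i hi) hi)) with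
        ⟨_, _, h, -⟩ | ⟨h, -⟩ | ⟨-, h⟩
      · cases h
      · cases h
      · exact h
    refine ⟨exists_syncAll_step (fun i => (hmem i).2) he fun i hi => (key i hi).2, .erase e, rfl,
      Or.inr ⟨rfl, rfl⟩, fun i => ⟨fun hi => (key i hi).1, fun hi => ?_⟩⟩
    rw [(hs i).2 fun h => hi ((mem_labels_of_dec h).2 (by simp)), (hx i).2 hi]

/-- The action `a` in the decoration is common to all participating components, so they all keep the
event or all erase it, and they return to `Y` states together. -/
theorem syncAll_transformed_step_w (hA : ∀ i, (Dc i).alphabet = (Fc i).alphabet)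
    {c : ∀ i, XD i} {b : ∀ i, XF i} {a : WAction E} (he : a.event ∈ ⋃ i, (Fc i).alphabet)
    {u : TEvent E} {x x' : ∀ i, TState E (XD i) (XF i)}
    (hx : ∀ i, (a.event ∈ (Fc i).alphabet → x i = .w (c i) (b i) a) ∧
      (a.event ∉ (Fc i).alphabet → x i = .y (c i) (b i)))
    (h : (syncAll (transformed (localTPOs Dc Fc))).step x (some u) x') :
    u = .env a.event a ∧ ∃ c' b', (∀ i, x' i = .y (c' i) (b' i)) ∧
      (syncAll Fc).step b (some a.event) b' ∧
      ((a = .keep a.event ∧ (syncAll Dc).step c (some a.event) c') ∨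
        (a = .erase a.event ∧ c' = c)) := by
  have hs := syncAll_step_some h
  have hmem := mem_observer_states (p := fun i d f => .w d f a) (fun i d f h => ⟨h.1, h.2.1⟩) h.1 hx
  have hw : ∀ i, a.event ∈ (Fc i).alphabet →
      .w (c i) (b i) a ∈ (transformed (localTPOs Dc Fc) i).states :=
    fun i hi => (hx i).1 hi ▸ h.1 i
  have hsw : ∀ i, a.event ∈ (Fc i).alphabet → u ∈ (transformed (localTPOs Dc Fc) i).alphabet →
      (transformed (localTPOs Dc Fc) i).step (.w (c i) (b i) a) (some u) (x' i) := by
    intro i hi hu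
    rw [← (hx i).1 hi]
    exact (hs i).1 hu
  obtain ⟨j, hj⟩ := Set.mem_iUnion.1 ((syncAll _).step_event h)
  have hej : a.event ∈ (Fc j).alphabet := by
    by_contra hej
    have hsj := (hs j).1 hj
    rw [(hx j).2 hej] at hsj
    obtain ⟨e', rfl, -⟩ := transformed_step_y hsj
    obtain ⟨i, hi⟩ := Set.mem_iUnion.1 he
    cases (transformed_step_w (hsw i hi (plain_mem_alphabet (mem_iUnion_of_plain hj) i))).1
  obtain ⟨rfl, -⟩ := transformed_step_w (hsw j hej hj)
  have key : ∀ i, ∃ c' b', x' i = .y c' b' ∧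
      ((a.event ∈ (Fc i).alphabet → (Fc i).step (b i) (some a.event) b') ∧
        (a.event ∉ (Fc i).alphabet → b' = b i)) ∧
      ((a = .keep a.event ∧ (a.event ∈ (Dc i).alphabet → (Dc i).step (c i) (some a.event) c') ∧
        (a.event ∉ (Dc i).alphabet → c' = c i)) ∨ (a = .erase a.event ∧ c' = c i)) := by
    intro i
    rw [hA i]
    by_cases hi : a.event ∈ (Fc i).alphabet
    · obtain ⟨-, c', b', hq, hb, hc⟩ := transformed_step_w (hsw i hi (env_mem_alphabet (hw i hi)))
      refine ⟨c', b', hq, ⟨fun _ => hb, fun h => (h hi).elim⟩, ?_⟩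
      rcases hc with ⟨ha, hc⟩ | hc
      · exact Or.inl ⟨ha, fun _ => hc, fun h => (h hi).elim⟩
      · exact Or.inr hc
    · refine ⟨c i, b i, ?_, ⟨fun h => (hi h).elim, fun _ => rfl⟩, ?_⟩
      · rw [(hs i).2 fun h => hi (mem_alphabet_of_env h), (hx i).2 hi]
      · cases a with
        | keep e => exact Or.inl ⟨rfl, fun h => (hi h).elim, fun _ => rfl⟩
        | erase e => exact Or.inr ⟨rfl, rfl⟩
  choose c' b' hx' hb hc using key
  have hmem' : ∀ i, c' i ∈ (Dc i).states ∧ b' i ∈ (Fc i).states := by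
    intro i
    have := h.2.1 i
    rw [hx' i] at this
    exact this
  refine ⟨rfl, c', b', hx', ⟨fun i => (hmem i).2, fun i => (hmem' i).2,
    Or.inl ⟨_, rfl, he, hb⟩⟩, ?_⟩
  cases a with
  | keep e =>
    refine Or.inl ⟨rfl, fun i => (hmem i).1, fun i => (hmem' i).1, Or.inl ⟨_, rfl,
      (Set.iUnion_congr hA).symm ▸ he, fun i => ?_⟩⟩
    rcases hc i with ⟨-, h⟩ | ⟨h, -⟩
    · exact h
    · cases h
  | erase e =>
    refine Or.inr ⟨rfl, funext fun i => ?_⟩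
    rcases hc i with ⟨h, -⟩ | ⟨-, h⟩
    · cases h
    · exact h

/-! ### The specification of the edit constraint -/

/-- The number of consecutive erasures after an event. -/
def TEvent.erasures : TEvent E → ℕ → ℕ
  | .dec (.erase _) _, k => k + 1
  | .dec _ _, _ => 0
  | _, k => k

/-- The plant of the modular supervisor. -/
abbrev modularPlant (n : ℕ) (Dc : ∀ i, Automaton E (XD i)) (Fc : ∀ i, Automaton E (XF i)) :
    Automaton (TEvent E) ((∀ i, TState E (XD i) (XF i)) × ℕ) :=
  (syncAll (transformed (localTPOs Dc Fc))).sync (specification n (localTPOs Dc Fc))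

theorem dec_of_mem_specification {n : ℕ} {u : TEvent E}
    (h : u ∈ (specification n (localTPOs Dc Fc)).alphabet) :
    ∃ θ e, u = .dec θ e ∧ ∃ i, u ∈ (transformed (localTPOs Dc Fc) i).alphabet := by
  rcases h with ⟨i, xd, xf, e, q, h, rfl⟩ | ⟨i, xd, xf, e, q, h, rfl⟩ | ⟨i, xd, xf, e, α, q, h, rfl⟩
  all_goals exact ⟨_, _, rfl, i, dec_mem_alphabet h.1 ((localTPOs Dc Fc i).step_event h)⟩

theorem dec_mem_specification {n : ℕ} {i : ι} {θ : Label E} {e : E}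
    {p q : TState E (XD i) (XF i)}
    (h : (transformed (localTPOs Dc Fc) i).step p (some (.dec θ e)) q) :
    .dec θ e ∈ (specification n (localTPOs Dc Fc)).alphabet := by
  rcases h with h | ⟨-, -, -, _, -, _, -, h⟩
  · cases h with
    | z h =>
      obtain ⟨h1, h2, a, hl, ha, h⟩ := h
      cases ha
      cases h with
      | zz h => exact Or.inr (Or.inr ⟨i, _, _, _, _, _, ⟨h1, h2, _, hl, rfl, .zz h⟩, rfl⟩)
      | zw1 h h' => exact Or.inr (Or.inl ⟨i, _, _, _, _, ⟨h1, h2, _, hl, rfl, .zw1 h h'⟩, rfl⟩)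
      | zw2 h => exact Or.inl ⟨i, _, _, _, _, ⟨h1, h2, _, hl, rfl, .zw2 h⟩, rfl⟩
  · cases h

theorem specification_step {n k k' : ℕ} {u : TEvent E}
    (h : (specification n (localTPOs Dc Fc)).step k (some u) k') : k ≤ n ∧ k' = u.erasures k := by
  obtain ⟨hk, ⟨_, ⟨i, xd, xf, e, q, h, rfl⟩, hu, rfl⟩ |
    ⟨_, ⟨i, xd, xf, e, q, h, rfl⟩ | ⟨i, xd, xf, e, α, q, h, rfl⟩, hu, rfl⟩⟩ := h <;>
  cases hu <;> exact ⟨hk, rfl⟩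

/-- The specification takes part in every executable decision, never moves alone, and ignores all
other events, so its state is the erasure count. The last disjunct records that the count cannot
leave the value `n + 1`, where the specification has no transitions. -/
theorem modularPlant_step {n : ℕ} {x x' : ∀ i, TState E (XD i) (XF i)} {k k' : ℕ}
    {l : Option (TEvent E)} (h : (modularPlant n Dc Fc).step (x, k) l (x', k')) :
    ∃ u, l = some u ∧ (syncAll (transformed (localTPOs Dc Fc))).step x (some u) x' ∧
      k' = u.erasures k ∧ (k ≤ n ∨ k' = k) := by
  obtain ⟨-, ⟨u, rfl, -, h1, h2⟩ | ⟨hl, h1, hk⟩ | ⟨hl, -, h2⟩⟩ := h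
  · obtain ⟨hk, hk'⟩ := specification_step h2
    exact ⟨u, rfl, h1, hk', Or.inl hk⟩
  · dsimp only at hk
    subst hk
    cases l with
    | none =>
      obtain ⟨-, -, ⟨_, h, -⟩ | ⟨-, i, h, -⟩⟩ := h1
      · cases h
      · exact (transformed_not_silent _ _ h).elim
    | some u =>
      refine ⟨u, rfl, h1, ?_, Or.inr rfl⟩
      obtain hl | ⟨u', hu', hu, hnot⟩ := hl
      · cases hl
      · cases hu'
        cases u with
        | plain e => rfl
        | env e a => rfl
        | dec θ e =>
          obtain ⟨i, hi⟩ := Set.mem_iUnion.1 hu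
          exact (hnot (dec_mem_specification ((syncAll_step_some h1 i).1 hi))).elim
  · obtain rfl | ⟨u, rfl, hu, hnot⟩ := hl
    · obtain ⟨-, ⟨_, -, h, -⟩ | ⟨_, -, h, -⟩⟩ := h2 <;> cases h
    · obtain ⟨_, _, -, i, hi⟩ := dec_of_mem_specification hu
      exact (hnot (Set.mem_iUnion.2 ⟨i, hi⟩)).elim

theorem modularPlant_plain_step {n : ℕ} {x x' : ∀ i, TState E (XD i) (XF i)} {k : ℕ} {e : E}
    (hk : k ≤ n + 1) (h : (syncAll (transformed (localTPOs Dc Fc))).step x (some (.plain e)) x') :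
    (modularPlant n Dc Fc).step (x, k) (some (.plain e)) (x', k) := by
  refine ⟨⟨(syncAll _).step_left h, hk⟩, Or.inr (Or.inl ⟨Or.inr ⟨_, rfl,
    (syncAll _).step_event h, fun hu => ?_⟩, h, rfl⟩)⟩
  obtain ⟨_, _, hu, -⟩ := dec_of_mem_specification hu
  cases hu

/-! ### Simulation of the supervisor by three-player observers of the composition -/

/-- The desired observer `D` and the observer `F` of a system with language `L` are represented by
the observers `Dc` and `Fc` of its components. -/
structure IsModularModel (L : Set (List E)) (Dc : ∀ i, Automaton E (XD i))
    (Fc : ∀ i, Automaton E (XF i)) (D : Automaton E YD) (F : Automaton E YF)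
    (RD : (∀ i, XD i) → YD → Prop) (RF : (∀ i, XF i) → YF → Prop) : Prop where
  alphabet_desired : ∀ i, (Dc i).alphabet = (Fc i).alphabet
  alphabet : F.alphabet = ⋃ i, (Fc i).alphabet
  sim_desired : IsSimulation (syncAll Dc) D RD
  sim : IsSimulation (syncAll Fc) F RF
  enabled : ∀ {b f e f'}, RF b f → F.step f (some e) f' → ∀ i, e ∈ (Fc i).alphabet →
    ∃ b', (Fc i).step (b i) (some e) b'
  init_unique : ∀ f ∈ F.init, ∀ f' ∈ F.init, f = f'
  path_unique : ∀ {s : List E} {f f₁ f₂}, F.Path f (s.map some) f₁ → F.Path f (s.map some) f₂ →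
    f₁ = f₂
  lang : ∀ s, s ∈ L ↔ ∃ f₀ ∈ F.init, ∃ f, F.Path f₀ (s.map some) f

/-- The states of the modular plant that represent a state of a three-player observer. -/
def RepresentsTPO (Fc : ∀ i, Automaton E (XF i)) (RD : (∀ i, XD i) → YD → Prop)
    (RF : (∀ i, XF i) → YF → Prop) (x : ∀ i, TState E (XD i) (XF i)) : TState E YD YF → Prop
  | .y d f => ∃ c b, RD c d ∧ RF b f ∧ ∀ i, x i = .y (c i) (b i)
  | .z d f e => e ∈ ⋃ i, (Fc i).alphabet ∧ ∃ c b, RD c d ∧ RF b f ∧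
      ∀ i, (e ∈ (Fc i).alphabet → x i = .z (c i) (b i) e) ∧
        (e ∉ (Fc i).alphabet → x i = .y (c i) (b i))
  | .w d f a => a.event ∈ ⋃ i, (Fc i).alphabet ∧ ∃ c b, RD c d ∧ RF b f ∧
      ∀ i, (a.event ∈ (Fc i).alphabet → x i = .w (c i) (b i) a) ∧
        (a.event ∉ (Fc i).alphabet → x i = .y (c i) (b i))

variable {L : Set (List E)} {D : Automaton E YD} {F : Automaton E YF}
  {RD : (∀ i, XD i) → YD → Prop} {RF : (∀ i, XF i) → YF → Prop} {n : ℕ}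

/-- The event of a `Z` or `W` state belongs to some component, and that component is then not at a
`Y` state. -/
theorem RepresentsTPO.isY {x : ∀ i, TState E (XD i) (XF i)} {p : TState E YD YF}
    (h : RepresentsTPO Fc RD RF x p) (hx : ∀ i, (x i).IsY) : p.IsY := by
  cases p with
  | y d f => trivial
  | z d f e =>
    obtain ⟨he, c, b, -, -, h⟩ := h
    obtain ⟨i, hi⟩ := Set.mem_iUnion.1 he
    have := hx i
    rw [(h i).1 hi] at this
    exact this.elim
  | w d f a =>
    obtain ⟨he, c, b, -, -, h⟩ := h
    obtain ⟨i, hi⟩ := Set.mem_iUnion.1 he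
    have := hx i
    rw [(h i).1 hi] at this
    exact this.elim

namespace IsModularModel

variable (M : IsModularModel L Dc Fc D F RD RF)

include M

theorem mem_tpoStates {x : ∀ i, TState E (XD i) (XF i)} {p : TState E YD YF}
    (h : RepresentsTPO Fc RD RF x p) : p ∈ tpoStates D F := by
  cases p with
  | y d f =>
    obtain ⟨c, b, hc, hb, -⟩ := h
    exact ⟨M.sim_desired.mem hc, M.sim.mem hb⟩
  | z d f e =>
    obtain ⟨he, c, b, hc, hb, -⟩ := h
    exact ⟨M.sim_desired.mem hc, M.sim.mem hb, M.alphabet ▸ he⟩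
  | w d f a =>
    obtain ⟨he, c, b, hc, hb, -⟩ := h
    exact ⟨M.sim_desired.mem hc, M.sim.mem hb, M.alphabet ▸ he⟩

theorem exists_admissible {x x' : ∀ i, TState E (XD i) (XF i)} {u : TEvent E}
    {p : TState E YD YF} (hp : RepresentsTPO Fc RD RF x p)
    (h : (syncAll (transformed (localTPOs Dc Fc))).step x (some u) x') :
    ∃ q, Admissible D F p u.rename q ∧ u.rename ∈ labels F.alphabet ∧
      (∀ k, u.erasures k = erasureCount p u.rename k) ∧ RepresentsTPO Fc RD RF x' q := by
  cases p with
  | y d f =>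
    obtain ⟨c, b, hc, hb, hx⟩ := hp
    obtain ⟨e, he, rfl, ⟨b', hb'⟩, hx'⟩ := syncAll_transformed_step_y hx h
    obtain ⟨f', hf', -⟩ := M.sim.step hb hb'
    exact ⟨.z d f e, .yz hf', F.step_event hf', fun _ => rfl, he, c, b, hc, hb, hx'⟩
  | z d f e =>
    obtain ⟨he, c, b, hc, hb, hx⟩ := hp
    rcases syncAll_transformed_step_z M.alphabet_desired he hx h with
      ⟨θ, c', rfl, hc', hx'⟩ | ⟨⟨b', hb'⟩, a, rfl, ⟨rfl, ha, c', hc'⟩ | ⟨rfl, ha⟩, hx'⟩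
    · obtain ⟨d', hd', hcd⟩ := M.sim_desired.step hc hc'
      refine ⟨.z d' f e, .zz hd', ?_, fun _ => rfl, he, c', b, hcd, hb, hx'⟩
      change θ ∈ F.alphabet
      rw [M.alphabet, ← Set.iUnion_congr M.alphabet_desired]
      exact (syncAll Dc).step_event hc'
    · obtain ⟨d', hd', -⟩ := M.sim_desired.step hc hc'
      obtain ⟨f', hf', -⟩ := M.sim.step hb hb'
      rw [ha] at hx' he hd' hf' ⊢
      exact ⟨.w d f (.keep _), .zw1 hd' hf', trivial, fun _ => rfl, he, c, b, hc, hb, hx'⟩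
    · obtain ⟨f', hf', -⟩ := M.sim.step hb hb'
      rw [ha] at hx' he hf' ⊢
      exact ⟨.w d f (.erase _), .zw2 hf', F.step_event hf', fun _ => rfl, he, c, b, hc, hb, hx'⟩
  | w d f a =>
    obtain ⟨he, c, b, hc, hb, hx⟩ := hp
    obtain ⟨rfl, c', b', hx', hb', hc'⟩ :=
      syncAll_transformed_step_w M.alphabet_desired he hx h
    obtain ⟨f', hf', hbf⟩ := M.sim.step hb hb'
    cases a with
    | keep e =>
      rcases hc' with ⟨-, hc'⟩ | ⟨h, -⟩
      · obtain ⟨d', hd', hcd⟩ := M.sim_desired.step hc hc'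
        exact ⟨.y d' f', .wy1 hd' hf', F.step_event hf', fun _ => rfl, c', b', hcd, hbf, hx'⟩
      · cases h
    | erase e =>
      rcases hc' with ⟨h, -⟩ | ⟨-, rfl⟩
      · cases h
      · exact ⟨.y d f', .wy2 hf', F.step_event hf', fun _ => rfl, c', b', hc, hbf, hx'⟩

/-- Every transition of the plant that respects the constraint is simulated. -/
theorem exists_constrained_step {x x' : (∀ i, TState E (XD i) (XF i)) × ℕ}
    {l : Option (TEvent E)} {p : TState E YD YF} (hp : RepresentsTPO Fc RD RF x.1 p)
    (h : (modularPlant n Dc Fc).step x l x') (hx : x.2 ≤ n) (hx' : x'.2 ≤ n) :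
    ∃ u, l = some u ∧ ∃ q,
      (constrained n (largestTPO D F)).step (p, x.2) (some u.rename) (q, x'.2) ∧
        RepresentsTPO Fc RD RF x'.1 q := by
  obtain ⟨u, rfl, h, hk, -⟩ := modularPlant_step h
  obtain ⟨q, hq, hl, hu, hr⟩ := M.exists_admissible hp h
  exact ⟨u, rfl, q, ⟨⟨M.mem_tpoStates hp, M.mem_tpoStates hr, _, hl, rfl, hq⟩, hx, hx', _, rfl,
    hk.trans (hu _)⟩, hr⟩

/-- Components with `e` execute it by the `enabled` property; all others use the added self-loop. -/
theorem exists_plain_step {x : ∀ i, TState E (XD i) (XF i)} {d : YD} {f f' : YF} {e : E}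
    (hp : RepresentsTPO Fc RD RF x (.y d f))
    (hx : ∀ i, x i ∈ (localTPOs Dc Fc i).states) (h : F.step f (some e) f') :
    ∃ x', (syncAll (transformed (localTPOs Dc Fc))).step x (some (.plain e)) x' := by
  have he : e ∈ ⋃ i, (Fc i).alphabet := M.alphabet ▸ F.step_event h
  obtain ⟨c, b, hc, hb, hxy⟩ := hp
  refine exists_syncAll_step hx (Set.mem_iUnion.2 ?_) fun i _ => ?_
  · exact (Set.mem_iUnion.1 he).imp fun i _ => plain_mem_alphabet he i
  · have hxi := hx i
    rw [hxy i] at hxi ⊢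
    by_cases hi : e ∈ (Fc i).alphabet
    · obtain ⟨b', hb'⟩ := M.enabled hb h i hi
      have hz : .z (c i) (b i) e ∈ tpoStates (Dc i) (Fc i) := ⟨hxi.1, hxi.2, hi⟩
      exact ⟨_, Or.inl (.y ⟨hxi, hz, _, hi, rfl, .yz hb'⟩)⟩
    · obtain ⟨j, hj⟩ := Set.mem_iUnion.1 he
      exact ⟨_, Or.inr ⟨hxi, trivial, rfl, j, fun h => hi (h ▸ hj), e, ⟨hj, hi⟩, rfl⟩⟩

theorem exists_init {x : (∀ i, TState E (XD i) (XF i)) × ℕ} (hx : x ∈ (modularPlant n Dc Fc).init) :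
    ∃ p ∈ (largestTPO D F).init, RepresentsTPO Fc RD RF x.1 p ∧ x.2 = 0 := by
  choose c hc b hb hxy using hx.1
  obtain ⟨d, hd, hcd⟩ := M.sim_desired.init c hc
  obtain ⟨f, hf, hbf⟩ := M.sim.init b hb
  exact ⟨.y d f, ⟨d, hd, f, hf, rfl⟩, ⟨c, b, hcd, hbf, hxy⟩, hx.2⟩

end IsModularModel

/-! ### The supervisor as a complete three-player observer -/

theorem supCN_sub {Q : Type*} (uc : Set E) (A : Automaton E Q) : (supCN uc A).Sub A :=
  (supCN_isGreatest uc A).1.1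

/-- The modular supervisor of the observers of the components. -/
abbrev localSupervisor (n : ℕ) (Dc : ∀ i, Automaton E (XD i)) (Fc : ∀ i, Automaton E (XF i)) :
    Automaton (TEvent E) ((∀ i, TState E (XD i) (XF i)) × ℕ) :=
  modularSupervisor n (localTPOs Dc Fc)

theorem localSupervisor_sub : (localSupervisor n Dc Fc).Sub (modularPlant n Dc Fc) :=
  supCN_sub _ _

theorem localSupervisor_not_silent (x y : (∀ i, TState E (XD i) (XF i)) × ℕ) :
    ¬ (localSupervisor n Dc Fc).step x none y := by
  intro h
  obtain ⟨u, hu, -⟩ := modularPlant_step (localSupervisor_sub.step _ _ _ h)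
  cases hu

theorem localSupervisor_coreachable {x : (∀ i, TState E (XD i) (XF i)) × ℕ}
    (hx : x ∈ (localSupervisor n Dc Fc).states) :
    ∃ y ∈ (localSupervisor n Dc Fc).marked, ∃ t : List (TEvent E),
      (localSupervisor n Dc Fc).Path x (t.map some) y := by
  have hS := (supCN_isGreatest (TEvent.uncontrollable E) (modularPlant n Dc Fc)).1
  obtain ⟨y, hy, t, p⟩ := hS.2.2.2 x hx (hS.2.1 x hx)
  exact ⟨y, hy, t.reduceOption, (p.eq_map_some localSupervisor_not_silent).symm ▸ p⟩

theorem localSupervisor_marked {x : (∀ i, TState E (XD i) (XF i)) × ℕ}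
    (hx : x ∈ (localSupervisor n Dc Fc).marked) : (∀ i, (x.1 i).IsY) ∧ x.2 ≤ n := by
  have h := localSupervisor_sub.marked hx
  exact ⟨fun i => (h.1 i).2, h.2⟩

/-- Follow a path to a marked state, where the count is at most `n`, and argue backwards: a
transition starts with a count of at most `n` or leaves it unchanged. -/
theorem localSupervisor_count_le {x : (∀ i, TState E (XD i) (XF i)) × ℕ}
    (hx : x ∈ (localSupervisor n Dc Fc).states) : x.2 ≤ n := by
  obtain ⟨y, hy, t, p⟩ := localSupervisor_coreachable hx
  replace hy := (localSupervisor_marked hy).2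
  generalize t.map some = t at p
  induction p with
  | nil x => exact hy
  | cons h p ih =>
    have ih := ih ((localSupervisor n Dc Fc).step_right h) hy
    obtain ⟨u, -, -, -, h | h⟩ := modularPlant_step (localSupervisor_sub.step _ _ _ h)
    · exact h
    · exact h ▸ ih

/-- The substructure of the constrained largest three-player observer on the states that are
represented by states of the supervisor. -/
def inducedTPO (n : ℕ) (Dc : ∀ i, Automaton E (XD i)) (Fc : ∀ i, Automaton E (XF i))
    (D : Automaton E YD) (F : Automaton E YF) (RD : (∀ i, XD i) → YD → Prop)
    (RF : (∀ i, XF i) → YF → Prop) : Automaton (Label E) (TState E YD YF × ℕ) :=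
  (constrained n (largestTPO D F)).remove
    {p | ¬ ∃ x ∈ (localSupervisor n Dc Fc).states, RepresentsTPO Fc RD RF x.1 p.1 ∧ x.2 = p.2}

theorem inducedTPO_sub :
    (inducedTPO n Dc Fc D F RD RF).Sub (constrained n (largestTPO D F)) where
  alphabet := rfl
  states := Set.sdiff_subset
  step _ _ _ h := h.1
  init := Set.sdiff_subset
  marked := Set.sdiff_subset

/-- `v` is the run of a string of the supervisor. -/
def IsSupervised (n : ℕ) (Dc : ∀ i, Automaton E (XD i)) (Fc : ∀ i, Automaton E (XF i))
    (v : List (Round E)) : Prop :=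
  ∃ t ∈ (localSupervisor n Dc Fc).lang, runWord v = t.map TEvent.rename

theorem IsSupervised.of_append {v w : List (Round E)} (h : IsSupervised n Dc Fc (v ++ w)) :
    IsSupervised n Dc Fc v := by
  obtain ⟨t, ⟨x, hx, y, p⟩, ht⟩ := h
  rw [runWord_append] at ht
  obtain ⟨t₁, t₂, rfl, h₁, -⟩ := List.map_eq_append_iff.1 ht.symm
  have p := p.path localSupervisor_not_silent
  rw [List.map_append] at p
  obtain ⟨z, p, -⟩ := p.split
  exact ⟨t₁, ⟨x, hx, z, p.wpath⟩, h₁.symm⟩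

/-! ### Supervised runs, their extensions, and completeness of the induced structure -/

namespace IsModularModel

variable (M : IsModularModel L Dc Fc D F RD RF)

include M

theorem exists_inducedTPO_step {x x' : (∀ i, TState E (XD i) (XF i)) × ℕ}
    {l : Option (TEvent E)} {p : TState E YD YF} (hp : RepresentsTPO Fc RD RF x.1 p)
    (h : (localSupervisor n Dc Fc).step x l x') :
    ∃ u, l = some u ∧ ∃ q,
      (inducedTPO n Dc Fc D F RD RF).step (p, x.2) (some u.rename) (q, x'.2) ∧
        RepresentsTPO Fc RD RF x'.1 q := by
  have hx := (localSupervisor n Dc Fc).step_left h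
  have hx' := (localSupervisor n Dc Fc).step_right h
  obtain ⟨u, hu, q, hq, hr⟩ := M.exists_constrained_step hp (localSupervisor_sub.step _ _ _ h)
    (localSupervisor_count_le hx) (localSupervisor_count_le hx')
  exact ⟨u, hu, q, ⟨hq, not_not.2 ⟨x, hx, hp, rfl⟩, not_not.2 ⟨x', hx', hr, rfl⟩⟩, hr⟩

theorem exists_inducedTPO_path {x x' : (∀ i, TState E (XD i) (XF i)) × ℕ}
    {t : List (TEvent E)} {p : TState E YD YF} (hp : RepresentsTPO Fc RD RF x.1 p)
    (h : (localSupervisor n Dc Fc).Path x (t.map some) x') :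
    ∃ q, (inducedTPO n Dc Fc D F RD RF).Path (p, x.2) ((t.map TEvent.rename).map some) (q, x'.2) ∧
      RepresentsTPO Fc RD RF x'.1 q := by
  induction t generalizing x p with
  | nil => cases h; exact ⟨p, .nil _, hp⟩
  | cons u t ih =>
    cases h with
    | cons h₁ h =>
      obtain ⟨u', hu, p₁, hs, hp₁⟩ := M.exists_inducedTPO_step hp h₁
      cases hu
      obtain ⟨q, hq, hr⟩ := ih hp₁ h
      exact ⟨q, .cons hs hq, hr⟩

theorem exists_inducedTPO_init {x : (∀ i, TState E (XD i) (XF i)) × ℕ}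
    (hx : x ∈ (localSupervisor n Dc Fc).init) :
    ∃ d ∈ D.init, ∃ f ∈ F.init, (TState.y d f, x.2) ∈ (inducedTPO n Dc Fc D F RD RF).init ∧
      RepresentsTPO Fc RD RF x.1 (.y d f) := by
  obtain ⟨p, hp, hr, h0⟩ := M.exists_init (localSupervisor_sub.init hx)
  have hp' := hp
  obtain ⟨d, hd, f, hf, rfl⟩ := hp'
  exact ⟨d, hd, f, hf, ⟨⟨hp, h0⟩, not_not.2 ⟨x, (localSupervisor n Dc Fc).init_sub hx, hr, rfl⟩⟩, hr⟩

/-- A path of the supervisor to a marked state completes the current round. -/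
theorem completesRuns {x x' : (∀ i, TState E (XD i) (XF i)) × ℕ} {t : List (TEvent E)}
    {p : TState E YD YF} (hp : RepresentsTPO Fc RD RF x.1 p)
    (h : (localSupervisor n Dc Fc).Path x (t.map some) x')
    (hx' : x' ∈ (localSupervisor n Dc Fc).marked) : CompletesRuns p (t.map TEvent.rename) := by
  obtain ⟨q, hq, hr⟩ := M.exists_inducedTPO_path hp h
  exact completesRuns_of_path (q := (q, x'.2)) (hr.isY (localSupervisor_marked hx').1)
    (hq.mono inducedTPO_sub.step)

theorem exists_run_of_mem_markedLang {t : List (TEvent E)}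
    (ht : t ∈ (localSupervisor n Dc Fc).markedLang) : ∃ ω, runWord ω = t.map TEvent.rename := by
  obtain ⟨x, hx, y, hy, p⟩ := ht
  obtain ⟨d, -, f, -, -, hr⟩ := M.exists_inducedTPO_init hx
  obtain ⟨ω, hω⟩ := M.completesRuns hr (p.path localSupervisor_not_silent) hy
  exact ⟨ω, hω.symm⟩

/-- The path of the supervisor and the run of the induced structure are produced together, so that
they end in corresponding states, and the observer state is tied to the edit projection. -/
theorem exists_path_of_isSupervised {v : List (Round E)} (hv : IsSupervised n Dc Fc v) :
    ∃ x₀ ∈ (localSupervisor n Dc Fc).init, ∃ x, ∃ t : List (TEvent E),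
      runWord v = t.map TEvent.rename ∧ (localSupervisor n Dc Fc).Path x₀ (t.map some) x ∧
      ∃ p ∈ (inducedTPO n Dc Fc D F RD RF).init, ∃ d f,
        (inducedTPO n Dc Fc D F RD RF).Path p ((runWord v).map some) (.y d f, x.2) ∧
        RepresentsTPO Fc RD RF x.1 (.y d f) ∧
        ∃ f₀ ∈ F.init, F.Path f₀ ((editProj v).map some) f := by
  obtain ⟨t, ⟨x₀, hx₀, x, p⟩, ht⟩ := hv
  have p := p.path localSupervisor_not_silent
  obtain ⟨d₀, -, f₀, hf₀, hi, hr⟩ := M.exists_inducedTPO_init hx₀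
  obtain ⟨q, hq, hqr⟩ := M.exists_inducedTPO_path hr p
  rw [← ht] at hq
  obtain ⟨d, f, rfl, hf⟩ := constrained_path_runWord rfl (hq.mono inducedTPO_sub.step)
  exact ⟨x₀, hx₀, x, t, ht, p, _, hi, d, f, hq, hqr, f₀, hf₀, hf⟩

theorem editProj_mem {v : List (Round E)} (hv : IsSupervised n Dc Fc v) : editProj v ∈ L := by
  obtain ⟨_, _, _, _, _, _, _, _, _, f, _, _, f₀, hf₀, hf⟩ := M.exists_path_of_isSupervised hv
  exact (M.lang _).2 ⟨f₀, hf₀, f, hf⟩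

theorem hasRun_inducedTPO {v : List (Round E)} (hv : IsSupervised n Dc Fc v) :
    HasRun (inducedTPO n Dc Fc D F RD RF) v := by
  obtain ⟨_, _, x, _, _, _, p, hp, d, f, hpath, _⟩ := M.exists_path_of_isSupervised hv
  exact ⟨p, hp, (.y d f, x.2), trivial, hpath⟩

/-- The plant can execute the event, and `plain` events are uncontrollable, so the supervisor cannot
disable it. -/
theorem exists_supervisor_plain_step {x : (∀ i, TState E (XD i) (XF i)) × ℕ}
    (hx : x ∈ (localSupervisor n Dc Fc).states) {d : YD} {f f' : YF} {e : E}
    (hp : RepresentsTPO Fc RD RF x.1 (.y d f)) (h : F.step f (some e) f') :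
    ∃ x', (localSupervisor n Dc Fc).step x (some (.plain e)) x' := by
  have hS := (supCN_isGreatest (TEvent.uncontrollable E) (modularPlant n Dc Fc)).1
  obtain ⟨x', hx'⟩ := M.exists_plain_step hp (localSupervisor_sub.states hx).1 h
  have hs := modularPlant_plain_step (n := n) (localSupervisor_count_le hx).step hx'
  exact ⟨_, hS.2.2.1 x hx _ ((modularPlant n Dc Fc).step_right hs) _ trivial hs⟩

/-- Every run of the supervisor can be extended by every event of the system. -/
theorem exists_extension {v : List (Round E)} {e : E} (hv : IsSupervised n Dc Fc v)
    (he : editProj v ++ [e] ∈ L) : ∃ c : Round E, c.event = e ∧ IsSupervised n Dc Fc (v ++ [c]) := by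
  obtain ⟨x₀, hx₀, x, t, ht, hpath, _, _, d, f, _, hr, f₀, hf₀, hf⟩ :=
    M.exists_path_of_isSupervised hv
  obtain ⟨f₀', hf₀', f', hf'⟩ := (M.lang _).1 he
  -- By determinism of `F`, the path for the longer string passes through the state `f` reached
  -- after `v`, so `e` is enabled at `f`.
  rw [M.init_unique _ hf₀' _ hf₀, List.map_append] at hf'
  obtain ⟨f₁, hf₁, hs⟩ := hf'.split
  rw [M.path_unique hf₁ hf] at hs
  cases hs with
  | cons hs _ =>
    have hx := hpath.mem_states ((localSupervisor n Dc Fc).init_sub hx₀)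
    obtain ⟨x', hx'⟩ := M.exists_supervisor_plain_step hx hr hs
    -- Nonblockingness completes the round begun with `e`. The path to the marked state may contain
    -- further rounds, so it is cut after the first one below.
    obtain ⟨y, hy, t', q⟩ := localSupervisor_coreachable ((localSupervisor n Dc Fc).step_right hx')
    have q : (localSupervisor n Dc Fc).Path x ((.plain e :: t').map some) y := .cons hx' q
    obtain ⟨ω, hω⟩ := M.completesRuns hr q hy
    cases ω with
    | nil => simp [runWord] at hω
    | cons c ω =>
      have hω' : (TEvent.plain e :: t').map TEvent.rename = c.word ++ runWord ω := hω
      refine ⟨c, ?_, ?_⟩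
      · have := (List.cons.inj hω').1
        cases this
        rfl
      · obtain ⟨t₁, t₂, h12, h₁, -⟩ := List.map_eq_append_iff.1 hω'
        rw [h12, List.map_append] at q
        obtain ⟨z, q, -⟩ := q.split
        refine ⟨t ++ t₁, ⟨x₀, hx₀, z, ?_⟩, ?_⟩
        · exact (hpath.wpath).trans q.wpath
        · rw [runWord_append, List.map_append, ht, h₁]
          simp [runWord]

theorem exists_editFunction_of_isSupervised {ω : List (Round E)} (hω : IsSupervised n Dc Fc ω) :
    ∃ f : EditFunction E,
      (∀ s ∈ L, ∃ v, IsSupervised n Dc Fc v ∧ editProj v = s ∧ runString v = f.output s) ∧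
        runString ω = f.output (editProj ω) := by
  refine exists_editFunction (fun s e hs => ?_) (fun v w => IsSupervised.of_append)
    (fun v e => M.exists_extension) hω
  obtain ⟨f₀, hf₀, f, hf⟩ := (M.lang _).1 hs
  rw [List.map_append] at hf
  obtain ⟨f₁, hf₁, -⟩ := hf.split
  exact (M.lang _).2 ⟨f₀, hf₀, f₁, hf₁⟩

/-- The representing supervisor state is not marked, because marked states have all components at
`Y` states. Being coreachable, it has a transition, which is simulated. -/
theorem exists_inducedTPO_step_of_not_isY {p : TState E YD YF × ℕ}
    (hp : p ∈ (inducedTPO n Dc Fc D F RD RF).states) (hy : ¬ p.1.IsY) :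
    ∃ l q, (inducedTPO n Dc Fc D F RD RF).step p l q := by
  obtain ⟨p, k⟩ := p
  obtain ⟨x, hx, hr, rfl⟩ := not_not.1 hp.2
  obtain ⟨y, hym, t, h⟩ := localSupervisor_coreachable hx
  cases t with
  | nil =>
    cases h
    exact (hy (hr.isY (localSupervisor_marked hym).1)).elim
  | cons u t =>
    cases h with
    | cons h _ =>
      obtain ⟨u', -, q, hq, -⟩ := M.exists_inducedTPO_step hr h
      exact ⟨_, _, hq⟩

theorem inducedTPO_mem_completeTPOs {ω : List (Round E)} (hω : IsSupervised n Dc Fc ω) :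
    inducedTPO n Dc Fc D F RD RF ∈ completeTPOs n D F L := by
  refine ⟨inducedTPO_sub, ⟨fun p hp hz => ?_, fun p hp hw => ?_, fun p hp hy l q h => ?_,
    fun s hs => ?_⟩⟩
  · refine M.exists_inducedTPO_step_of_not_isY hp fun hy => ?_
    obtain ⟨p | p | p, k⟩ := p <;> first | exact hz | exact hy
  · refine M.exists_inducedTPO_step_of_not_isY hp fun hy => ?_
    obtain ⟨p | p | p, k⟩ := p <;> first | exact hw | exact hy
  · obtain ⟨p, k⟩ := p
    obtain ⟨q, k'⟩ := q
    obtain ⟨x, hx, hr, rfl⟩ := not_not.1 hp.2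
    obtain ⟨⟨-, -, a, -, rfl, ha⟩, -, -, a', ha', hk⟩ := h
    cases ha'
    dsimp only at ha hk
    cases ha with
    | yz hf =>
      -- A transition from a `Y` state is determined by its label, including the erasure count, so
      -- the simulated supervisor transition has the required target.
      obtain ⟨x', hx'⟩ := M.exists_supervisor_plain_step hx hr hf
      obtain ⟨u, hu, q', hq', -⟩ := M.exists_inducedTPO_step hr hx'
      cases hu
      obtain ⟨⟨-, -, a, -, h1, ha⟩, -, -, a', h2, hk'⟩ := hq'.1
      cases h1
      cases h2
      cases ha
      dsimp only at hk'
      rw [hk]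
      exact hk' ▸ hq'
    | _ => exact hy.elim
  -- The given supervised run starts the extension process, whose edit function yields a supervised
  -- run for every string of the language.
  · obtain ⟨f, hf, -⟩ := M.exists_editFunction_of_isSupervised hω
    obtain ⟨v, hv, hvs, -⟩ := hf s hs
    exact ⟨v, M.hasRun_inducedTPO hv, hvs⟩

/-- The run itself shows that a complete structure exists, so the All Edit Structure is the greatest
one and contains the induced structure. -/
theorem hasRun_allEditStructure {v : List (Round E)} (hv : IsSupervised n Dc Fc v) :
    HasRun (allEditStructure n D F L) v := by
  have hA := M.inducedTPO_mem_completeTPOs hv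
  have hsub := (allEditStructure_isGreatest n D F L ⟨_, hA⟩).2 _ hA
  obtain ⟨p, hp, q, hq, h⟩ := M.hasRun_inducedTPO hv
  exact ⟨p, hsub.init hp, q, hq, h.mono hsub.step⟩

end IsModularModel

end Modular

/-! ### Soundness of the compositional approach -/

section Soundness

open Automaton

variable {E ι : Type*} {Q : ι → Type*} {G : ∀ i, Automaton E (Q i)} {S : ∀ i, Set (Q i)}
  {r : ∀ i, Setoid (Q i)} {ro rb : ∀ i, Setoid (Set (Quotient (r i)))}

/-- The abstracted desired observer of a component. -/
abbrev abstractDesired (G : ∀ i, Automaton E (Q i)) (S : ∀ i, Set (Q i)) (r : ∀ i, Setoid (Q i))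
    (ro : ∀ i, Setoid (Set (Quotient (r i)))) (i : ι) : Automaton E (Quotient (ro i)) :=
  (((G i).quot (r i)).observer.quot (ro i)).desired ((G i).abstractViolations (S i) (r i) (ro i))

/-- The abstracted observer of a component. -/
abbrev abstractObserver (G : ∀ i, Automaton E (Q i)) (r : ∀ i, Setoid (Q i))
    (rb : ∀ i, Setoid (Set (Quotient (r i)))) (i : ι) : Automaton E (Quotient (rb i)) :=
  ((G i).quot (r i)).observer.quot (rb i)

theorem isModularModel_abstract [Finite ι] (hr : ∀ i, (G i).IsOpaqueObsEquiv (S i) (r i))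
    (hro : ∀ i, ((G i).quot (r i)).observer.IsBisimulation (ro i))
    (hrb : ∀ i, ((G i).quot (r i)).observer.IsBisimulation (rb i))
    (hne : ∀ i, ((G i).UR (G i).init).Nonempty) :
    IsModularModel (syncAll G).lang (abstractDesired G S r ro) (abstractObserver G r rb)
      ((syncAll G).observer.desired {X | X ⊆ modularSecret S}) (syncAll G).observer
      (RepresentsDesired G S r ro) (Represents G r rb) where
  alphabet_desired _ := rfl
  alphabet := rfl
  sim_desired := isSimulation_desired hr hro hne
  sim := isSimulation_observer hr hrb hne
  enabled h hs _ hi := h.enabled hr hs hi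
  init_unique := by rintro _ rfl _ rfl; rfl
  path_unique := observer_path_unique
  lang s := by
    -- With an empty initial estimate the observer would still have the empty path, although the
    -- language would be empty.
    have h : ((syncAll G).UR (syncAll G).init).Nonempty := by
      rw [UR_init_syncAll, Set.univ_pi_nonempty_iff]
      exact hne
    rw [mem_lang_iff_observer h]
    exact ⟨fun h => ⟨_, rfl, h⟩, by rintro ⟨_, rfl, h⟩; exact h⟩

/-- An empty initial estimate consists vacuously of secret states only, so its class would have been
removed from the desired observer and the supervisor would have no initial state. -/
theorem UR_init_nonempty_of_supervisor {n : ℕ} (hr : ∀ i, (G i).IsOpaqueObsEquiv (S i) (r i))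
    {x : (∀ i, TState E (Quotient (ro i)) (Quotient (rb i))) × ℕ}
    (hx : x ∈ (localSupervisor n (abstractDesired G S r ro) (abstractObserver G r rb)).init)
    (i : ι) : ((G i).UR (G i).init).Nonempty := by
  obtain ⟨c, ⟨⟨_, rfl, rfl⟩, hc⟩, -⟩ := (localSupervisor_sub.init hx).1 i
  by_contra h
  refine hc ⟨_, ⟨UR_init_mem_observer _, ?_⟩, rfl⟩
  rw [(hr i).UR_init, Set.not_nonempty_iff_eq_empty.1 h, Set.image_empty]
  exact Set.empty_subset _

end Soundness

theorem mainTheorem1 {E : Type*} {m : ℕ} {Q : Fin m → Type*}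
    -- the modular system with its sets of secret states, and the bound `n` of the constraint
    (G : ∀ i, Automaton E (Q i)) (S : ∀ i, Set (Q i)) (hS : ∀ i, S i ⊆ (G i).states) (n : ℕ)
    -- the abstractions of the components and of their observers
    (r : ∀ i, Setoid (Q i)) (hr : ∀ i, (G i).IsOpaqueObsEquiv (S i) (r i))
    (ro : ∀ i, Setoid (Set (Quotient (r i))))
    (hro : ∀ i, ((G i).quot (r i)).IsOpaqueBisimulation (Quotient.mk (r i) '' S i) (ro i))
    (rb : ∀ i, Setoid (Set (Quotient (r i))))
    (hrb : ∀ i, ((G i).quot (r i)).observer.IsBisimulation (rb i))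
    -- the language and the All Edit Structure of the system, and the supervisor
    (L : Set (List E)) (hL : L = (Automaton.syncAll G).lang)
    (AES : Automaton (Label E) (TState E (Set (∀ i, Q i)) (Set (∀ i, Q i)) × ℕ))
    (hAES : AES = systemAES n (Automaton.syncAll G) (modularSecret S))
    (Sup : Automaton (TEvent E) ((∀ i, TState E (Quotient (ro i)) (Quotient (rb i))) × ℕ))
    (hSup : Sup = modularSupervisor n fun i => abstractTPO (G i) (S i) (r i) (ro i) (rb i)) :
    -- accepted strings are runs up to renaming
    (∀ t ∈ Sup.markedLang, ∃ ω, runWord ω = t.map TEvent.rename) ∧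
    -- every string that is a run yields a decision of an edit function embedded in the AES
    (∀ t ∈ Sup.lang, ∀ ω, runWord ω = t.map TEvent.rename →
      HasRun AES ω ∧ editProj ω ∈ L ∧
        ∃ f : EditFunction E, f.EmbeddedIn L AES ∧ runString ω = f.output (editProj ω)) ∧
    -- every edit function that is realized by the supervisor is embedded in the AES
    (∀ f : EditFunction E,
      (∀ s ∈ L, ∃ t ∈ Sup.lang, ∃ ω, runWord ω = t.map TEvent.rename ∧
        editProj ω = s ∧ runString ω = f.output s) →
      f.EmbeddedIn L AES) := by
  have hSup' : Sup = localSupervisor n (abstractDesired G S r ro) (abstractObserver G r rb) := hSup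
  subst hL hAES hSup'
  -- Nonemptiness of the initial estimates is not assumed. It comes from an initial state of the
  -- supervisor, which every string of the supervisor provides.
  have model {x} (hx : x ∈ (localSupervisor n (abstractDesired G S r ro)
      (abstractObserver G r rb)).init) :=
    isModularModel_abstract hr (fun i => (hro i).isBisimulation) hrb
      (UR_init_nonempty_of_supervisor hr hx)
  have hrun : ∀ t ∈ (localSupervisor n (abstractDesired G S r ro) (abstractObserver G r rb)).lang,
      ∀ ω, runWord ω = t.map TEvent.rename →
        HasRun (systemAES n (Automaton.syncAll G) (modularSecret S)) ω := by
    rintro t ⟨x, hx, h⟩ ω hω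
    exact (model hx).hasRun_allEditStructure ⟨t, ⟨x, hx, h⟩, hω⟩
  refine ⟨?_, ?_, fun f hf s hs => ?_⟩
  · rintro t ⟨x, hx, h⟩
    exact (model hx).exists_run_of_mem_markedLang ⟨x, hx, h⟩
  · rintro t ⟨x, hx, h⟩ ω hω
    have hsup : IsSupervised n (abstractDesired G S r ro) (abstractObserver G r rb) ω :=
      ⟨t, ⟨x, hx, h⟩, hω⟩
    obtain ⟨f, hf, hfω⟩ := (model hx).exists_editFunction_of_isSupervised hsup
    refine ⟨hrun t ⟨x, hx, h⟩ ω hω, (model hx).editProj_mem hsup, f, fun s hs => ?_, hfω⟩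
    obtain ⟨v, ⟨t', ht', hv⟩, hvs, hvo⟩ := hf s hs
    exact ⟨v, hrun t' ht' v hv, hvs, hvo⟩
  · obtain ⟨t, ht, ω, hω, hωs, hωo⟩ := hf s hs
    exact ⟨ω, hrun t ht ω hω, hωs, hωo⟩
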